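/- Let $n\ge 1$, $1<q<\infty$, let $q'$ be the conjugate exponent, $1/q+1/q'=1$, and let $s>n/q'$. Let $\mathcal FL^q_s(\mathbb R^n)$ be the Banach space of all tempered distributions $f$ on $\mathbb R^n$ whose Fourier transform $\widehat f$ (normalized by $\widehat f(\xi)=\int_{\mathbb R^n} f(x)e^{-ix\cdot\xi}\,dx$ for integrable $f$) is a function with $$\|f\|_{\mathcal FL^q_s}=\Big(\int_{\mathbb R^n}\big((1+|\xi|^2)^{s/2}|\widehat f(\xi)|\big)^q\,d\xi\Big)^{1/q}<\infty .$$ Since $s>n/q'$, its elements are continuous functions and it is an algebra under pointwise multiplication. A linear subspace $I\subset\mathcal FL^q_s(\mathbb R^n)$ is an ideal if $fg\in I$ for all $f\in\mathcal FL^q_s(\mathbb R^n)$ and $g\in I$. For a closed set $E\subset\mathbb R^n$ let $I(E)$ be the set of all $f\in\mathcal FL^q_s(\mathbb R^n)$ with $f(x)=0$ for all $x\in E$, and let $J(E)$ be the closed ideal of $\mathcal FL^q_s(\mathbb R^n)$ generated by those $f\in\mathcal FL^q_s(\mathbb R^n)$ that vanish in a neighborhood of $E$, i.e. the intersection of all norm-closed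 ideals that contain these functions. The set $E$ is called a set of spectral synthesis for $\mathcal FL^q_s(\mathbb R^n)$ if $I(E)=J(E)$. **Proposition.** (i) If $1<q\le 2$ and $n/q'<s<n/q'+1$, then for every $x_0\in\mathbb R^n$ the set $\{x_0\}$ is a set of spectral synthesis for $\mathcal FL^q_s(\mathbb R^n)$. (ii) If $1<q<\infty$ and $s>n/q'+1$, then for every $x_0\in\mathbb R^n$ the set $\{x_0\}$ is not a set of spectral synthesis for $\mathcal FL^q_s(\mathbb R^n)$. -/

import Mathlib

open MeasureTheory SchwartzMap
open scoped ENNReal Topology FourierTransform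

namespace FourierWermer

/-- `ℝⁿ` with its Euclidean norm. -/
abbrev Rn (n : ℕ) : Type := EuclideanSpace ℝ (Fin n)

/-- The dilation `ξ ↦ (2π)⁻¹ ξ` of `ℝⁿ`. -/
noncomputable def dilation (n : ℕ) : Rn n ≃L[ℝ] Rn n :=
  (LinearEquiv.smulOfNeZero ℝ (Rn n) (2 * Real.pi)⁻¹
    (inv_ne_zero Real.two_pi_pos.ne')).toContinuousLinearEquiv

/-- The Fourier transform `φ̂(ξ) = ∫ φ(x) e^{-i x·ξ} dx` on the Schwartz space, obtained from
Mathlib's (whose kernel is `e^{-2π i x·ξ}`) by a dilation; see `fourierS_apply`. -/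
noncomputable def fourierS (n : ℕ) : 𝓢(Rn n, ℂ) →L[ℂ] 𝓢(Rn n, ℂ) :=
  (SchwartzMap.compCLMOfContinuousLinearEquiv ℂ (dilation n)).comp
    (FourierTransform.fourierCLM ℂ 𝓢(Rn n, ℂ))

theorem fourierS_apply (n : ℕ) (φ : 𝓢(Rn n, ℂ)) (ξ : Rn n) :
    fourierS n φ ξ = ∫ x, Complex.exp (-(Complex.I * (inner ℝ x ξ : ℝ))) * φ x := by
  have h : fourierS n φ ξ = 𝓕 (φ : Rn n → ℂ) ((2 * Real.pi)⁻¹ • ξ) := rfl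
  rw [h, Real.fourier_eq']
  refine integral_congr_ae (Filter.Eventually.of_forall fun x => ?_)
  have hp : (Real.pi : ℂ) ≠ 0 := by exact_mod_cast Real.pi_ne_zero
  simp only [smul_eq_mul, real_inner_smul_right]
  congr 2
  push_cast
  field_simp

/-- The Fourier transform of a tempered distribution: `⟨T̂, φ⟩ = ⟨T, φ̂⟩`. -/
noncomputable def fourierD {n : ℕ} (T : 𝓢'(Rn n, ℂ)) : 𝓢'(Rn n, ℂ) :=
  PointwiseConvergenceCLM.precomp ℂ (fourierS n) T

/-- The tempered distribution `T` is given by the function `g`: `⟨T, φ⟩ = ∫ φ g` for all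
Schwartz functions `φ`, the integrals being absolutely convergent. -/
def IsGivenBy {n : ℕ} (T : 𝓢'(Rn n, ℂ)) (g : Rn n → ℂ) : Prop :=
  AEStronglyMeasurable g volume ∧
    ∀ φ : 𝓢(Rn n, ℂ), Integrable (fun x => φ x * g x) ∧ T φ = ∫ x, φ x * g x

/-- The function giving a tempered distribution is unique up to null sets. -/
theorem IsGivenBy.ae_eq {n : ℕ} {T : 𝓢'(Rn n, ℂ)} {g h : Rn n → ℂ} (hg : IsGivenBy T g)
    (hh : IsGivenBy T h) : g =ᵐ[volume] h := by
  have hsm : ∀ (u : Rn n → ℝ) (hc : HasCompactSupport u) (hu : ContDiff ℝ ((⊤ : ℕ∞) : WithTop ℕ∞) u),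
      ∃ φ : 𝓢(Rn n, ℂ), ∀ x, φ x = (u x : ℂ) := by
    intro u hc hu
    have h1 : HasCompactSupport (Complex.ofRealCLM ∘ u) := hc.comp_left rfl
    have h2 : ContDiff ℝ ((⊤ : ℕ∞) : WithTop ℕ∞) (Complex.ofRealCLM ∘ u) := by fun_prop
    exact ⟨h1.toSchwartzMap h2, fun x => by simp⟩
  have key : ∀ {k : Rn n → ℂ}, IsGivenBy T k → LocallyIntegrable k volume := by
    intro k hk x
    let b : ContDiffBump x := ⟨1, 2, one_pos, one_lt_two⟩
    obtain ⟨φ, hφ⟩ := hsm b b.hasCompactSupport b.contDiff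
    refine ⟨Metric.closedBall x 1, Metric.closedBall_mem_nhds x one_pos, ?_⟩
    refine (hk.2 φ).1.integrableOn.congr_fun (fun y hy => ?_) measurableSet_closedBall
    simp [hφ, b.one_of_mem_closedBall hy]
  refine ae_eq_of_integral_contDiff_smul_eq (key hg) (key hh) fun u hu hc => ?_
  obtain ⟨φ, hφ⟩ := hsm u hc hu
  have := (hg.2 φ).2.symm.trans (hh.2 φ).2
  simpa [hφ, Complex.real_smul] using this

/-- The weight `⟨ξ⟩ = (1 + |ξ|²)^{1/2}`. -/
noncomputable def japanese {n : ℕ} (ξ : Rn n) : ℝ := (1 + ‖ξ‖ ^ 2) ^ (1 / 2 : ℝ)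

theorem japanese_rpow {n : ℕ} (s : ℝ) (ξ : Rn n) :
    japanese ξ ^ s = (1 + ‖ξ‖ ^ 2) ^ (s / 2) := by
  rw [japanese, ← Real.rpow_mul (by positivity)]; congr 1; ring

/-- The weighted norm `‖g‖_{L^q_s} = (∫ (⟨ξ⟩^s |g(ξ)|)^q dξ)^{1/q}` as an extended real number. -/
noncomputable def weightedNorm {n : ℕ} (q s : ℝ) (g : Rn n → ℂ) : ℝ≥0∞ :=
  eLpNorm (fun ξ => japanese ξ ^ s * ‖g ξ‖) (ENNReal.ofReal q) volume

/-- `‖T‖_{FL^q_s} = ‖T̂‖_{L^q_s}` for a tempered distribution `T`. The value is `∞` if `T̂` is not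
given by a function; otherwise that function is unique up to null sets, so that the infimum is
taken over a single value, see `distNorm_eq`. -/
noncomputable def distNorm {n : ℕ} (q s : ℝ) (T : 𝓢'(Rn n, ℂ)) : ℝ≥0∞ :=
  ⨅ (g : Rn n → ℂ) (_ : IsGivenBy (fourierD T) g), weightedNorm q s g

/-- `FL^q_s(ℝⁿ)` as a space of tempered distributions. -/
def FLDist (n : ℕ) (q s : ℝ) : Set 𝓢'(Rn n, ℂ) := {T | distNorm q s T < ∞}

/-- The infimum in `distNorm` is just the norm of the function that gives `T̂`. -/
theorem distNorm_eq {n : ℕ} (q s : ℝ) {T : 𝓢'(Rn n, ℂ)} {g : Rn n → ℂ}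
    (hg : IsGivenBy (fourierD T) g) : distNorm q s T = weightedNorm q s g := by
  refine le_antisymm (iInf₂_le g hg) (le_iInf₂ fun h hh => le_of_eq (eLpNorm_congr_ae ?_))
  filter_upwards [hg.ae_eq hh] with x hx
  simp [hx]

/-- Hölder: `L^q_s ⊆ L¹` for `s > n / q'`. -/
theorem integrable_of_weighted {n : ℕ} {q q' s : ℝ} (hq : 1 < q) (hqq' : 1 / q + 1 / q' = 1)
    (hs : n / q' < s) {g : Rn n → ℂ} (hm : AEStronglyMeasurable g volume)
    (hg : weightedNorm q s g < ∞) : Integrable g := by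
  have hc : q.HolderConjugate q' :=
    Real.holderConjugate_iff.2 ⟨hq, by simpa [one_div] using hqq'⟩
  have hq' : 0 < q' := hc.symm.pos
  have hd : Continuous fun ξ : Rn n => (1 + ‖ξ‖ ^ 2 : ℝ) := by fun_prop
  have hcont : ∀ r : ℝ, Continuous fun ξ : Rn n => (1 + ‖ξ‖ ^ 2 : ℝ) ^ r := fun r =>
    hd.rpow_const fun ξ => Or.inl (by positivity)
  have h1 : MemLp (fun ξ : Rn n => japanese ξ ^ s * ‖g ξ‖) (ENNReal.ofReal q) volume := by
    refine ⟨?_, hg⟩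
    simp_rw [japanese_rpow]
    exact (hcont _).aestronglyMeasurable.mul hm.norm
  have h2 : MemLp (fun ξ : Rn n => (1 + ‖ξ‖ ^ 2 : ℝ) ^ (-(s / 2))) (ENNReal.ofReal q') volume := by
    rw [← integrable_norm_rpow_iff (hcont _).aestronglyMeasurable (by simpa using hq') (by simp)]
    have : Integrable fun ξ : Rn n => (1 + ‖ξ‖ ^ 2 : ℝ) ^ (-(s * q') / 2) :=
      integrable_rpow_neg_one_add_norm_sq (by
        simpa using (div_lt_iff₀ hq').1 hs)
    refine this.congr (Filter.Eventually.of_forall fun ξ => ?_)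
    have h0 : (0:ℝ) ≤ 1 + ‖ξ‖ ^ 2 := by positivity
    simp only [ENNReal.toReal_ofReal hq'.le]
    rw [Real.norm_of_nonneg (by positivity), ← Real.rpow_mul h0]
    congr 1; ring
  have : (ENNReal.ofReal q').HolderTriple (ENNReal.ofReal q) 1 := by
    have := hc.symm.ennrealOfReal
    exact this
  have h3 := memLp_one_iff_integrable.1 (h1.mul' (r := 1) h2)
  refine (integrable_norm_iff hm).1 (h3.congr (Filter.Eventually.of_forall fun ξ => ?_))
  simp only [japanese_rpow]
  rw [← mul_assoc, ← Real.rpow_add (by positivity)]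
  simp

/-- For `1 < q < ∞` and `s > n / q'` every element of `FL^q_s(ℝⁿ)` is given by exactly one
continuous function. -/
theorem existsUnique_continuous {n : ℕ} {q q' s : ℝ} (hq : 1 < q) (hqq' : 1 / q + 1 / q' = 1)
    (hs : n / q' < s) {T : 𝓢'(Rn n, ℂ)} (hT : T ∈ FLDist n q s) :
    ∃! f : C(Rn n, ℂ), IsGivenBy T f := by
  obtain ⟨g, hg⟩ := iInf_lt_iff.1 (show distNorm q s T < ∞ from hT)
  obtain ⟨hg, hlt⟩ := iInf_lt_iff.1 hg
  have hi : Integrable g := integrable_of_weighted hq hqq' hs hg.1 hlt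
  have hcF : Continuous (𝓕 g) := by
    exact VectorFourier.fourierIntegral_continuous Real.continuous_fourierChar
      (L := innerₗ (Rn n)) continuous_inner hi
  have hcont : Continuous (𝓕⁻ g) := by
    have : 𝓕⁻ g = fun x => 𝓕 g (-x) := by ext x; exact Real.fourierInv_eq_fourier_neg g x
    rw [this]; exact hcF.comp continuous_neg
  have hbd : ∀ x, ‖𝓕⁻ g x‖ ≤ ∫ ξ, ‖g ξ‖ := by
    intro x
    rw [Real.fourierInv_eq_fourier_neg]
    exact VectorFourier.norm_fourierIntegral_le_integral_norm _ _ _ _ _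
  let D := dilation n
  let f : C(Rn n, ℂ) := ⟨fun x => (((2 * Real.pi) ^ n)⁻¹ : ℝ) • 𝓕⁻ g (D x), by fun_prop⟩
  have hf : IsGivenBy T f := by
    refine ⟨f.continuous.aestronglyMeasurable, fun φ => ⟨?_, ?_⟩⟩
    · refine φ.integrable.mul_bdd (c := |((2 * Real.pi) ^ n)⁻¹| * ∫ ξ, ‖g ξ‖)
        f.continuous.aestronglyMeasurable (Filter.Eventually.of_forall fun x => ?_)
      simp only [f, ContinuousMap.coe_mk, norm_smul, Real.norm_eq_abs]
      exact mul_le_mul_of_nonneg_left (hbd _) (abs_nonneg _)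
    · let χ : 𝓢(Rn n, ℂ) := SchwartzMap.compCLMOfContinuousLinearEquiv ℂ D.symm φ
      let ψ : 𝓢(Rn n, ℂ) := 𝓕⁻ χ
      have hψ : fourierS n ψ = φ := by
        have : 𝓕 ψ = χ := FourierTransform.fourier_fourierInv_eq χ
        ext x
        change (𝓕 ψ) (D x) = φ x
        rw [this]
        change φ (D.symm (D x)) = φ x
        simp
      have h1 : T φ = ∫ x, ψ x * g x := by
        rw [← (hg.2 ψ).2, ← hψ]; rfl
      have h2 : ∫ x, ψ x * g x = ∫ x, χ x * 𝓕⁻ g x := by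
        have hn : Continuous fun p : Rn n × Rn n => (-innerₗ (Rn n)) p.1 p.2 := by
          have := (continuous_inner (𝕜 := ℝ) (E := Rn n)).neg
          exact this
        have hχ : Integrable (χ : Rn n → ℂ) volume := χ.integrable
        have hh := VectorFourier.integral_fourierIntegral_smul_eq_flip (L := -innerₗ (Rn n))
          Real.continuous_fourierChar hn hχ hi
        have e1 : ∀ u : Rn n → ℂ, VectorFourier.fourierIntegral Real.fourierChar volume
            (-innerₗ (Rn n)) u = 𝓕⁻ u := by
          intro u; ext x
          simp [VectorFourier.fourierIntegral, Real.fourierInv_eq]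
        have e2 : (-innerₗ (Rn n)).flip = -innerₗ (Rn n) := by
          ext x y; simp [real_inner_comm]
        rw [e2, e1, e1] at hh
        simpa [ψ, SchwartzMap.fourierInv_coe] using hh
      have h3 := Measure.integral_comp_inv_smul (volume : Measure (Rn n))
        (fun x => χ x * 𝓕⁻ g x) (2 * Real.pi)
      have h4 : ∀ x, χ ((2 * Real.pi)⁻¹ • x) = φ x := fun x => by
        change φ (D.symm (D x)) = φ x
        simp
      have hpos : (0 : ℝ) < (2 * Real.pi) ^ n := by positivity
      rw [h1, h2]
      simp only [h4, finrank_euclideanSpace, Fintype.card_fin, abs_of_pos hpos] at h3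
      have h5 : ∀ x, φ x * f x = (((2 * Real.pi) ^ n)⁻¹ : ℝ) • (φ x * 𝓕⁻ g ((2 * Real.pi)⁻¹ • x)) := by
        intro x
        change φ x * ((((2 * Real.pi) ^ n)⁻¹ : ℝ) • 𝓕⁻ g ((2 * Real.pi)⁻¹ • x)) = _
        rw [mul_smul_comm]
      simp_rw [h5]
      rw [integral_smul, h3, smul_smul, inv_mul_cancel₀ hpos.ne', one_smul]
  refine ⟨f, hf, fun f' hf' => ?_⟩
  exact ContinuousMap.coe_injective
    ((Continuous.ae_eq_iff_eq volume f'.continuous f.continuous).1 (IsGivenBy.ae_eq hf' hf))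

/-- The norm `‖f‖_{FL^q_s}` of a continuous function `f`, that is, of the tempered distribution
given by `f` (which is unique if it exists; the value is `∞` if there is none). -/
noncomputable def flNorm {n : ℕ} (q s : ℝ) (f : C(Rn n, ℂ)) : ℝ≥0∞ :=
  ⨅ (T : 𝓢'(Rn n, ℂ)) (_ : IsGivenBy T f), distNorm q s T

/-- `FL^q_s(ℝⁿ)` as a space of continuous functions: the continuous functions which, as tempered
distributions, belong to `FL^q_s(ℝⁿ)`. For `1 < q < ∞` and `s > n / q'` every element of
`FL^q_s(ℝⁿ)` is given by exactly one continuous function (`existsUnique_continuous`), so that this is all of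
it. -/
def FL (n : ℕ) (q s : ℝ) : Set C(Rn n, ℂ) := {f | ∃ T ∈ FLDist n q s, IsGivenBy T f}

/-- An ideal in `FL^q_s(ℝⁿ)`: a linear subspace `I` of `FL^q_s(ℝⁿ)` with `f g ∈ I` whenever
`f ∈ FL^q_s(ℝⁿ)` and `g ∈ I`. -/
def IsIdeal {n : ℕ} (q s : ℝ) (I : Submodule ℂ C(Rn n, ℂ)) : Prop :=
  (I : Set C(Rn n, ℂ)) ⊆ FL n q s ∧ ∀ f ∈ FL n q s, ∀ g ∈ I, f * g ∈ I

/-- `I` is closed in `FL^q_s(ℝⁿ)` with respect to the norm of `FL^q_s(ℝⁿ)`. -/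
def IsNormClosed {n : ℕ} (q s : ℝ) (I : Set C(Rn n, ℂ)) : Prop :=
  ∀ f ∈ FL n q s, (∀ ε : ℝ≥0∞, 0 < ε → ∃ g ∈ I, flNorm q s (f - g) < ε) → f ∈ I

/-- `I(E)`: the functions in `FL^q_s(ℝⁿ)` that vanish on `E`. -/
def vanishingIdeal {n : ℕ} (q s : ℝ) (E : Set (Rn n)) : Set C(Rn n, ℂ) :=
  {f | f ∈ FL n q s ∧ ∀ x ∈ E, f x = 0}

/-- `J₀(E)`: the functions in `FL^q_s(ℝⁿ)` that vanish in a neighbourhood of `E`. -/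
def vanishingNear {n : ℕ} (q s : ℝ) (E : Set (Rn n)) : Set C(Rn n, ℂ) :=
  {f | f ∈ FL n q s ∧ ∀ᶠ x in 𝓝ˢ E, f x = 0}

/-- `J(E)`: the closed ideal in `FL^q_s(ℝⁿ)` generated by `J₀(E)`, that is, the intersection of
all closed ideals that contain `J₀(E)`. -/
def closedIdealNear {n : ℕ} (q s : ℝ) (E : Set (Rn n)) : Set C(Rn n, ℂ) :=
  {f | f ∈ FL n q s ∧ ∀ I : Submodule ℂ C(Rn n, ℂ), IsIdeal q s I →
    IsNormClosed q s (I : Set C(Rn n, ℂ)) → vanishingNear q s E ⊆ I → f ∈ I}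

/-- The closed set `E ⊆ ℝⁿ` is a set of spectral synthesis for `FL^q_s(ℝⁿ)`: `I(E) = J(E)`. -/
def IsSpectralSynthesisSet {n : ℕ} (q s : ℝ) (E : Set (Rn n)) : Prop :=
  vanishingIdeal q s E = closedIdealNear q s E

end FourierWermer

/-! Write `f ∈ FL n q s` as `f = synth x₀ g`, where `g` is the Fourier transform of `f` up to a
unimodular factor and lies in `L^q_s`; `flNorm_lt_iff` makes this dictionary precise and removes
distributions from the rest of the argument. By Hölder, `L^q_s ⊆ L¹` for `s > n / q'`. Products of
functions become convolutions of their `g`, and `f x₀ = 0` becomes `∫ g = 0`. Evaluation at `x₀` is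
thus continuous, and `J ⊆ I` for a point.

Above the threshold `n / q' + 1`, the function `⟨ξ⟩ g` lies in `L^q_{s-1} ⊆ L¹`, so the derivative
at `x₀` exists and depends continuously on `f`. By the product rule, the functions whose value and
derivative vanish at `x₀` form a closed ideal. It contains everything that vanishes near `x₀`, hence
`J`, but `I` contains a function with nonzero derivative at `x₀`.

Below the threshold, `I ⊆ J` follows by cutting off. Functions `g` of mean zero may be approximated
by continuous compactly supported ones of mean zero. For such `g` let `φ` be a cut-off equal to 1
near `x₀`, at scale `ε`. Then `f - f φ` vanishes near `x₀`, while `f φ` corresponds to the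
convolution of `g` with `εⁿ Φ(ε ·)`. Mean zero allows subtraction of `Φ(ε ξ)` under the integral,
which gains a factor `ε` and gives the bound `ε^(n+1) (1 + |ε ξ|)^(-N)`. Its weighted norm is of
order `ε^(n + 1 - s - n/q) = ε^(n/q' + 1 - s)`, which tends to zero; see
`tendsto_weightedNorm_convolution`. -/

namespace FourierWermer

/-! ### Fourier inversion centred at a point -/

/-- The function `x ↦ (2π)⁻ⁿ ∫ e^{i (x - x₀)·ξ} g(ξ) dξ`. -/
noncomputable def synth {n : ℕ} (x₀ : Rn n) (g : Rn n → ℂ) (x : Rn n) : ℂ :=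
  (((2 * Real.pi) ^ n)⁻¹ : ℝ) • 𝓕 g ((2 * Real.pi)⁻¹ • (x₀ - x))

theorem continuous_fourier_of_integrable {n : ℕ} {g : Rn n → ℂ} (hi : Integrable g) :
    Continuous (𝓕 g) :=
  VectorFourier.fourierIntegral_continuous Real.continuous_fourierChar
    (L := innerₗ (Rn n)) continuous_inner hi

theorem norm_fourier_le_integral_norm {n : ℕ} (g : Rn n → ℂ) (x : Rn n) :
    ‖𝓕 g x‖ ≤ ∫ ξ, ‖g ξ‖ :=
  VectorFourier.norm_fourierIntegral_le_integral_norm _ _ _ _ _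

theorem continuous_synth {n : ℕ} (x₀ : Rn n) {g : Rn n → ℂ} (hi : Integrable g) :
    Continuous (synth x₀ g) := by
  have := continuous_fourier_of_integrable hi
  unfold synth
  fun_prop

theorem norm_synth_le {n : ℕ} (x₀ : Rn n) (g : Rn n → ℂ) (x : Rn n) :
    ‖synth x₀ g x‖ ≤ ((2 * Real.pi) ^ n)⁻¹ * ∫ ξ, ‖g ξ‖ := by
  have hpos : (0 : ℝ) < (2 * Real.pi) ^ n := by positivity
  rw [synth, norm_smul, Real.norm_of_nonneg (inv_nonneg.2 hpos.le)]
  exact mul_le_mul_of_nonneg_left (norm_fourier_le_integral_norm _ _) (inv_nonneg.2 hpos.le)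

/-- The inverse of `fourierS`. -/
noncomputable def fourierSInv (n : ℕ) : 𝓢(Rn n, ℂ) →L[ℂ] 𝓢(Rn n, ℂ) :=
  (FourierTransform.fourierInvCLM ℂ 𝓢(Rn n, ℂ)).comp
    (SchwartzMap.compCLMOfContinuousLinearEquiv ℂ (dilation n).symm)

theorem fourierS_fourierSInv {n : ℕ} (φ : 𝓢(Rn n, ℂ)) : fourierS n (fourierSInv n φ) = φ := by
  have : 𝓕 (fourierSInv n φ) =
      SchwartzMap.compCLMOfContinuousLinearEquiv ℂ (dilation n).symm φ :=
    FourierTransform.fourier_fourierInv_eq _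
  ext x
  change (𝓕 (fourierSInv n φ)) (dilation n x) = φ x
  rw [this]
  change φ ((dilation n).symm (dilation n x)) = φ x
  simp

theorem fourierSInv_fourierS {n : ℕ} (φ : 𝓢(Rn n, ℂ)) : fourierSInv n (fourierS n φ) = φ := by
  have : SchwartzMap.compCLMOfContinuousLinearEquiv ℂ (dilation n).symm (fourierS n φ) = 𝓕 φ := by
    ext x
    change (𝓕 φ) (dilation n ((dilation n).symm x)) = (𝓕 φ) x
    simp
  change 𝓕⁻ (SchwartzMap.compCLMOfContinuousLinearEquiv ℂ (dilation n).symm (fourierS n φ)) = φ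
  rw [this]
  exact FourierTransform.fourierInv_fourier_eq φ

/-- Every integrable function is the Fourier transform of a tempered distribution. -/
theorem exists_isGivenBy_fourierD {n : ℕ} {g : Rn n → ℂ} (hi : Integrable g) :
    ∃ T : 𝓢'(Rn n, ℂ), IsGivenBy (fourierD T) g := by
  let G : 𝓢'(Rn n, ℂ) := Lp.toTemperedDistribution ((memLp_one_iff_integrable.2 hi).toLp g)
  -- Duality forces this choice: composing with `fourierS` must give back `G`.
  refine ⟨PointwiseConvergenceCLM.precomp ℂ (fourierSInv n) G, hi.1, fun φ => ⟨?_, ?_⟩⟩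
  · obtain ⟨C, hC⟩ := φ.decay 0 0
    exact hi.bdd_mul (c := C) φ.continuous.aestronglyMeasurable
      (Filter.Eventually.of_forall fun x => by simpa using hC.2 x)
  · change G (fourierSInv n (fourierS n φ)) = _
    rw [fourierSInv_fourierS, Lp.toTemperedDistribution_apply]
    refine integral_congr_ae ?_
    filter_upwards [MemLp.coeFn_toLp (memLp_one_iff_integrable.2 hi)] with x hx
    rw [hx, smul_eq_mul]

/-- Fourier inversion for distributions whose Fourier transform is an integrable function. -/
theorem IsGivenBy.synth {n : ℕ} {T : 𝓢'(Rn n, ℂ)} {g : Rn n → ℂ}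
    (hg : IsGivenBy (fourierD T) g) (hi : Integrable g) : IsGivenBy T (synth 0 g) := by
  refine ⟨(continuous_synth 0 hi).aestronglyMeasurable, fun φ => ⟨?_, ?_⟩⟩
  · exact φ.integrable.mul_bdd (c := ((2 * Real.pi) ^ n)⁻¹ * ∫ ξ, ‖g ξ‖)
      (continuous_synth 0 hi).aestronglyMeasurable
      (Filter.Eventually.of_forall fun x => norm_synth_le 0 g x)
  · let D := dilation n
    let χ : 𝓢(Rn n, ℂ) := SchwartzMap.compCLMOfContinuousLinearEquiv ℂ D.symm φ
    let ψ : 𝓢(Rn n, ℂ) := fourierSInv n φ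
    have h1 : T φ = ∫ x, ψ x * g x := by
      rw [← (hg.2 ψ).2, ← fourierS_fourierSInv φ]
      simp only [ψ, fourierS_fourierSInv]
      change _ = T (fourierS n (fourierSInv n φ))
      rw [fourierS_fourierSInv]
    -- The multiplication formula moves the transform from `χ` to `g`. With the symmetric form
    -- `-innerₗ` the Fourier integral is the inverse transform.
    have h2 : ∫ x, ψ x * g x = ∫ x, χ x * 𝓕⁻ g x := by
      have hn : Continuous fun p : Rn n × Rn n => (-innerₗ (Rn n)) p.1 p.2 := by
        have := (continuous_inner (𝕜 := ℝ) (E := Rn n)).neg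
        exact this
      have hχ : Integrable (χ : Rn n → ℂ) volume := χ.integrable
      have hh := VectorFourier.integral_fourierIntegral_smul_eq_flip (L := -innerₗ (Rn n))
        Real.continuous_fourierChar hn hχ hi
      have e1 : ∀ u : Rn n → ℂ, VectorFourier.fourierIntegral Real.fourierChar volume
          (-innerₗ (Rn n)) u = 𝓕⁻ u := by
        intro u; ext x
        simp [VectorFourier.fourierIntegral, Real.fourierInv_eq]
      have e2 : (-innerₗ (Rn n)).flip = -innerₗ (Rn n) := by
        ext x y; simp [real_inner_comm]
      rw [e2, e1, e1] at hh
      have e3 : (ψ : Rn n → ℂ) = 𝓕⁻ (χ : Rn n → ℂ) := SchwartzMap.fourierInv_coe χ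
      rw [e3]
      simpa using hh
    have h3 := Measure.integral_comp_inv_smul (volume : Measure (Rn n))
      (fun x => χ x * 𝓕⁻ g x) (2 * Real.pi)
    have h4 : ∀ x, χ ((2 * Real.pi)⁻¹ • x) = φ x := fun x => by
      change φ (D.symm (D x)) = φ x
      simp
    have hpos : (0 : ℝ) < (2 * Real.pi) ^ n := by positivity
    rw [h1, h2]
    simp only [h4, finrank_euclideanSpace, Fintype.card_fin, abs_of_pos hpos] at h3
    have h5 : ∀ x, φ x * FourierWermer.synth 0 g x =
        (((2 * Real.pi) ^ n)⁻¹ : ℝ) • (φ x * 𝓕⁻ g ((2 * Real.pi)⁻¹ • x)) := by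
      intro x
      rw [FourierWermer.synth, mul_smul_comm, Real.fourierInv_eq_fourier_neg, zero_sub, smul_neg]
    simp_rw [h5]
    rw [integral_smul, h3, smul_smul, inv_mul_cancel₀ hpos.ne', one_smul]

/-- Multiplication by the character `ξ ↦ e^{-i a·ξ}`. -/
noncomputable def modulate {n : ℕ} (a : Rn n) (g : Rn n → ℂ) (ξ : Rn n) : ℂ :=
  Real.fourierChar (-inner ℝ ξ ((2 * Real.pi)⁻¹ • a)) • g ξ

/-- Translating the base point costs only a unimodular factor, which no weighted norm sees, so any
`x₀` may serve as origin. -/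
theorem synth_modulate {n : ℕ} (x₀ a : Rn n) (g : Rn n → ℂ) :
    synth x₀ (modulate a g) = synth (x₀ + a) g := by
  ext x
  simp only [synth, Real.fourier_eq, modulate]
  congr 2
  ext v
  rw [← mul_smul, ← AddChar.map_add_eq_mul]
  congr 2
  simp only [inner_smul_right, inner_sub_right, inner_add_right]
  ring

theorem norm_modulate {n : ℕ} (a : Rn n) (g : Rn n → ℂ) (ξ : Rn n) :
    ‖modulate a g ξ‖ = ‖g ξ‖ := by
  simp only [modulate, Circle.smul_def, norm_smul, Circle.norm_coe, one_mul]

theorem weightedNorm_modulate {n : ℕ} (q s : ℝ) (a : Rn n) (g : Rn n → ℂ) :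
    weightedNorm q s (modulate a g) = weightedNorm q s g := by
  simp [weightedNorm, norm_modulate]

theorem aestronglyMeasurable_modulate {n : ℕ} (a : Rn n) {g : Rn n → ℂ}
    (hg : AEStronglyMeasurable g volume) : AEStronglyMeasurable (modulate a g) volume := by
  have : Continuous fun ξ : Rn n =>
      (Real.fourierChar (-inner ℝ ξ ((2 * Real.pi)⁻¹ • a)) : ℂ) := by
    have := Real.continuous_fourierChar
    fun_prop
  exact this.aestronglyMeasurable.mul hg

/-- Two continuous functions giving the same distribution coincide, so Fourier inversion identifies
`f` with the integral of its transform; conversely an integrable `g` is the transform of some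
distribution. The strict bound lets the infima in `flNorm` be opened to produce an actual `g`. -/
theorem flNorm_lt_iff {n : ℕ} {q q' s : ℝ} (hq : 1 < q) (hqq' : 1 / q + 1 / q' = 1)
    (hs : n / q' < s) (x₀ : Rn n) {f : C(Rn n, ℂ)} {ε : ℝ≥0∞} :
    flNorm q s f < ε ↔ ∃ g : Rn n → ℂ, AEStronglyMeasurable g volume ∧
      weightedNorm q s g < ε ∧ ∀ x, f x = synth x₀ g x := by
  constructor
  · intro h
    obtain ⟨T, h⟩ := iInf_lt_iff.1 h
    obtain ⟨hT, h⟩ := iInf_lt_iff.1 h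
    obtain ⟨g, h⟩ := iInf_lt_iff.1 h
    obtain ⟨hg, h⟩ := iInf_lt_iff.1 h
    have hi := integrable_of_weighted hq hqq' hs hg.1 (h.trans_le le_top)
    refine ⟨modulate (-x₀) g, aestronglyMeasurable_modulate _ hg.1,
      by rwa [weightedNorm_modulate], fun x => ?_⟩
    rw [synth_modulate, add_neg_cancel]
    exact congr_fun ((Continuous.ae_eq_iff_eq volume f.continuous (continuous_synth 0 hi)).1
      (hT.ae_eq (hg.synth hi))) x
  · rintro ⟨g, hm, h, hf⟩
    have hm' := aestronglyMeasurable_modulate x₀ hm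
    have h' : weightedNorm q s (modulate x₀ g) < ε := by rwa [weightedNorm_modulate]
    have hi := integrable_of_weighted hq hqq' hs hm' (h'.trans_le le_top)
    obtain ⟨T, hT⟩ := exists_isGivenBy_fourierD hi
    have e : synth 0 (modulate x₀ g) = f := by
      rw [synth_modulate, zero_add]
      exact (funext hf).symm
    refine lt_of_le_of_lt (iInf₂_le T (e ▸ hT.synth hi)) ?_
    rwa [distNorm_eq q s hT]

theorem mem_FL_iff_flNorm_lt_top {n : ℕ} {q s : ℝ} {f : C(Rn n, ℂ)} :
    f ∈ FL n q s ↔ flNorm q s f < ∞ := by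
  simp only [FL, FLDist, Set.mem_ofPred_eq, flNorm, iInf_lt_iff]
  exact ⟨fun ⟨T, h1, h2⟩ => ⟨T, h2, h1⟩, fun ⟨T, h2, h1⟩ => ⟨T, h1, h2⟩⟩

theorem mem_FL_iff {n : ℕ} {q q' s : ℝ} (hq : 1 < q) (hqq' : 1 / q + 1 / q' = 1)
    (hs : n / q' < s) (x₀ : Rn n) {f : C(Rn n, ℂ)} :
    f ∈ FL n q s ↔ ∃ g : Rn n → ℂ, AEStronglyMeasurable g volume ∧
      weightedNorm q s g < ∞ ∧ ∀ x, f x = synth x₀ g x :=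
  mem_FL_iff_flNorm_lt_top.trans (flNorm_lt_iff hq hqq' hs x₀)

/-! ### Weighted norms: Hölder, Young and convolution -/

theorem continuous_japanese_rpow {n : ℕ} (s : ℝ) : Continuous fun ξ : Rn n => japanese ξ ^ s := by
  simp_rw [japanese_rpow]
  have hd : Continuous fun ξ : Rn n => (1 + ‖ξ‖ ^ 2 : ℝ) := by fun_prop
  exact hd.rpow_const fun ξ => Or.inl (by positivity)

theorem japanese_pos {n : ℕ} (ξ : Rn n) : 0 < japanese ξ := by
  unfold japanese; positivity

theorem norm_le_japanese {n : ℕ} (ξ : Rn n) : ‖ξ‖ ≤ japanese ξ := by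
  rw [japanese, ← Real.sqrt_eq_rpow]
  exact Real.le_sqrt_of_sq_le (by linarith)

theorem japanese_le_one_add_norm {n : ℕ} (ξ : Rn n) : japanese ξ ≤ 1 + ‖ξ‖ := by
  rw [japanese, ← Real.sqrt_eq_rpow]
  exact Real.sqrt_le_iff.2 ⟨by positivity, by nlinarith [norm_nonneg ξ]⟩

/-- The longer of `η` and `ξ - η` has length at least `‖ξ‖ / 2`, so `1 + ‖ξ‖²` is at most four times
the same expression for it. -/
theorem japanese_rpow_le_add {n : ℕ} {s : ℝ} (hs : 0 ≤ s) (ξ η : Rn n) :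
    japanese ξ ^ s ≤ 4 ^ (s / 2) * (japanese η ^ s + japanese (ξ - η) ^ s) := by
  have key : ∀ a b : Rn n, ‖a‖ ≤ ‖b‖ → japanese (a + b) ^ s ≤ 4 ^ (s / 2) * japanese b ^ s := by
    intro a b hab
    rw [japanese_rpow, japanese_rpow, ← Real.mul_rpow (by norm_num) (by positivity)]
    refine Real.rpow_le_rpow (by positivity) ?_ (by positivity)
    have := norm_add_le a b
    nlinarith [norm_nonneg (a + b)]
  have h4 : (0 : ℝ) ≤ 4 ^ (s / 2) := by positivity
  have p1 : 0 ≤ japanese η ^ s := (Real.rpow_pos_of_pos (japanese_pos _) _).le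
  have p2 : 0 ≤ japanese (ξ - η) ^ s := (Real.rpow_pos_of_pos (japanese_pos _) _).le
  rw [mul_add]
  rcases le_total ‖η‖ ‖ξ - η‖ with h | h
  · have := key _ _ h
    rw [add_sub_cancel] at this
    nlinarith
  · have := key _ _ h
    rw [sub_add_cancel] at this
    nlinarith

/-- Hölder's inequality: the `L¹` norm is bounded by the norm of `L^q_s` if `s > n / q'`. -/
theorem exists_eLpNorm_one_le_mul_weightedNorm {n : ℕ} {q q' s : ℝ} (hq : 1 < q)
    (hqq' : 1 / q + 1 / q' = 1) (hs : n / q' < s) :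
    ∃ C : ℝ≥0∞, C ≠ ∞ ∧ ∀ g : Rn n → ℂ, AEStronglyMeasurable g volume →
      eLpNorm g 1 volume ≤ C * weightedNorm q s g := by
  have hc : q.HolderConjugate q' :=
    Real.holderConjugate_iff.2 ⟨hq, by simpa [one_div] using hqq'⟩
  have hq' : 0 < q' := hc.symm.pos
  have h2 : MemLp (fun ξ : Rn n => japanese ξ ^ (-s)) (ENNReal.ofReal q') volume := by
    rw [← integrable_norm_rpow_iff (continuous_japanese_rpow _).aestronglyMeasurable
      (by simpa using hq') (by simp)]
    have : Integrable fun ξ : Rn n => (1 + ‖ξ‖ ^ 2 : ℝ) ^ (-(s * q') / 2) :=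
      integrable_rpow_neg_one_add_norm_sq (by simpa using (div_lt_iff₀ hq').1 hs)
    refine this.congr (Filter.Eventually.of_forall fun ξ => ?_)
    have h0 : (0:ℝ) ≤ 1 + ‖ξ‖ ^ 2 := by positivity
    simp only [ENNReal.toReal_ofReal hq'.le, japanese_rpow]
    rw [Real.norm_of_nonneg (by positivity), ← Real.rpow_mul h0]
    congr 1; ring
  have : (ENNReal.ofReal q').HolderTriple (ENNReal.ofReal q) 1 := hc.symm.ennrealOfReal
  refine ⟨_, h2.2.ne, fun g hm => ?_⟩
  have := eLpNorm_smul_le_mul_eLpNorm (p := ENNReal.ofReal q') (q := ENNReal.ofReal q) (r := 1)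
    ((continuous_japanese_rpow s).aestronglyMeasurable.mul hm.norm) h2.1
  refine le_trans (le_of_eq (eLpNorm_congr_norm_ae (Filter.Eventually.of_forall fun ξ => ?_))) this
  have h0 := japanese_pos ξ
  simp only [Pi.smul_apply', Pi.mul_apply, smul_eq_mul, ← mul_assoc]
  rw [← Real.rpow_add h0]
  simp

/-- Young's inequality for the convolution of a function in `L¹` with one in `L^q`. -/
theorem eLpNorm_lintegral_mul_sub_le {n : ℕ} {q : ℝ} (hq : 1 < q) {a b : Rn n → ℝ≥0∞}
    (ha : AEMeasurable a) (hb : AEMeasurable b) :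
    eLpNorm (fun ξ => ∫⁻ η, a η * b (ξ - η)) (ENNReal.ofReal q) volume ≤
      (∫⁻ η, a η) * eLpNorm b (ENNReal.ofReal q) volume := by
  have hq0 : 0 < q := by linarith
  have hc := Real.HolderConjugate.conjExponent hq
  set p := q.conjExponent
  have hp0 : 0 < p := hc.symm.pos
  have hne : ENNReal.ofReal q ≠ 0 := by simpa using hq0
  rw [eLpNorm_eq_lintegral_rpow_enorm_toReal hne (by simp),
    eLpNorm_eq_lintegral_rpow_enorm_toReal hne (by simp)]
  simp only [enorm_eq_self, ENNReal.toReal_ofReal hq0.le]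
  have hbp : AEMeasurable (fun z : Rn n × Rn n => b (z.1 - z.2)) (volume.prod volume) :=
    hb.comp_quasiMeasurePreserving (quasiMeasurePreserving_sub_of_right_invariant volume volume)
  have hbs : ∀ ξ, AEMeasurable fun η => b (ξ - η) := fun ξ =>
    hb.comp_quasiMeasurePreserving (quasiMeasurePreserving_sub_left_of_right_invariant volume ξ)
  -- Hölder after splitting `a = a^(1/p) · a^(1/q)`, with `p` conjugate to `q`.
  have hpt : ∀ ξ, (∫⁻ η, a η * b (ξ - η)) ^ q ≤
      (∫⁻ η, a η) ^ (q - 1) * ∫⁻ η, a η * b (ξ - η) ^ q := by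
    intro ξ
    have h := ENNReal.lintegral_mul_le_Lp_mul_Lq volume hc.symm (ha.pow_const (1 / p))
      ((ha.pow_const (1 / q)).mul (hbs ξ))
    have e1 : ∀ η, (a η ^ (1 / p)) ^ p = a η := fun η => by
      rw [← ENNReal.rpow_mul, one_div_mul_cancel hp0.ne', ENNReal.rpow_one]
    have e2 : ∀ η, (a η ^ (1 / q) * b (ξ - η)) ^ q = a η * b (ξ - η) ^ q := fun η => by
      rw [ENNReal.mul_rpow_of_nonneg _ _ hq0.le, ← ENNReal.rpow_mul, one_div_mul_cancel hq0.ne',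
        ENNReal.rpow_one]
    have e3 : ∀ η, a η ^ (1 / p) * (a η ^ (1 / q) * b (ξ - η)) = a η * b (ξ - η) := fun η => by
      rw [← mul_assoc, ← ENNReal.rpow_add_of_nonneg _ _ (by positivity) (by positivity)]
      have : 1 / p + 1 / q = 1 := by simpa [one_div] using hc.symm.inv_add_inv_eq_one
      rw [this, ENNReal.rpow_one]
    simp only [Pi.mul_apply, e1, e2, e3] at h
    calc (∫⁻ η, a η * b (ξ - η)) ^ q
        ≤ ((∫⁻ η, a η) ^ (1 / p) * (∫⁻ η, a η * b (ξ - η) ^ q) ^ (1 / q)) ^ q :=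
          ENNReal.rpow_le_rpow h hq0.le
      _ = _ := by
          rw [ENNReal.mul_rpow_of_nonneg _ _ hq0.le, ← ENNReal.rpow_mul, ← ENNReal.rpow_mul,
            one_div_mul_cancel hq0.ne', ENNReal.rpow_one]
          congr 2
          have := hc.symm.inv_add_inv_eq_one
          field_simp at this ⊢
          linarith
  -- Tonelli and translation invariance.
  have hint : ∫⁻ ξ, ∫⁻ η, a η * b (ξ - η) ^ q = (∫⁻ η, a η) * ∫⁻ ξ, b ξ ^ q := by
    rw [lintegral_lintegral_swap (ha.comp_snd.mul (hbp.pow_const q))]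
    have : ∀ η, ∫⁻ ξ, a η * b (ξ - η) ^ q = a η * ∫⁻ ξ, b ξ ^ q := fun η => by
      have hbq : AEMeasurable fun ξ => b (ξ - η) ^ q :=
        (hb.comp_quasiMeasurePreserving
          (measurePreserving_sub_right volume η).quasiMeasurePreserving).pow_const q
      rw [lintegral_const_mul'' _ hbq,
        lintegral_sub_right_eq_self (fun ξ => b ξ ^ q) η]
    simp_rw [this]
    rw [lintegral_mul_const'' _ ha]
  have hcm : AEMeasurable fun ξ => ∫⁻ η, a η * b (ξ - η) ^ q :=
    (ha.comp_snd.mul (hbp.pow_const q)).lintegral_prod_right'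
  calc (∫⁻ ξ, (∫⁻ η, a η * b (ξ - η)) ^ q) ^ (1 / q)
      ≤ (∫⁻ ξ, (∫⁻ η, a η) ^ (q - 1) * ∫⁻ η, a η * b (ξ - η) ^ q) ^ (1 / q) :=
        ENNReal.rpow_le_rpow (lintegral_mono hpt) (by positivity)
    _ = ((∫⁻ η, a η) ^ q * ∫⁻ ξ, b ξ ^ q) ^ (1 / q) := by
        rw [lintegral_const_mul'' _ hcm, hint, ← mul_assoc]
        congr 2
        nth_rw 2 [← ENNReal.rpow_one (∫⁻ η, a η)]
        rw [← ENNReal.rpow_add_of_nonneg _ _ (by linarith) zero_le_one]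
        simp
    _ = _ := by
        rw [ENNReal.mul_rpow_of_nonneg _ _ (by positivity), ← ENNReal.rpow_mul,
          mul_one_div_cancel hq0.ne', ENNReal.rpow_one]

open ContinuousLinearMap Convolution in
/-- `L^q_s` is an algebra under convolution if `s > n / q'`. -/
theorem weightedNorm_convolution_lt_top {n : ℕ} {q q' s : ℝ} (hq : 1 < q)
    (hqq' : 1 / q + 1 / q' = 1) (hs : n / q' < s) {g h : Rn n → ℂ}
    (hgm : AEStronglyMeasurable g volume) (hg : weightedNorm q s g < ∞)
    (hhm : AEStronglyMeasurable h volume) (hh : weightedNorm q s h < ∞) :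
    weightedNorm q s (g ⋆[mul ℂ ℂ] h) < ∞ := by
  have hc : q.HolderConjugate q' :=
    Real.holderConjugate_iff.2 ⟨hq, by simpa [one_div] using hqq'⟩
  have hs0 : 0 ≤ s := le_trans (div_nonneg n.cast_nonneg hc.symm.pos.le) hs.le
  have hgi := integrable_of_weighted hq hqq' hs hgm hg
  have hhi := integrable_of_weighted hq hqq' hs hhm hh
  let w : (Rn n → ℂ) → Rn n → ℝ≥0∞ := fun u ξ => ‖japanese ξ ^ s * ‖u ξ‖‖ₑ
  have hwm : ∀ {u : Rn n → ℂ}, AEStronglyMeasurable u volume → AEMeasurable (w u) := fun hu =>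
    ((continuous_japanese_rpow s).aestronglyMeasurable.mul hu.norm).enorm
  have hw : ∀ u : Rn n → ℂ, weightedNorm q s u = eLpNorm (w u) (ENNReal.ofReal q) volume :=
    fun u => eLpNorm_congr_enorm_ae (Filter.Eventually.of_forall fun ξ => by simp [w])
  let F₁ : Rn n → ℝ≥0∞ := fun ξ => ∫⁻ η, ‖g η‖ₑ * w h (ξ - η)
  let F₂ : Rn n → ℝ≥0∞ := fun ξ => ∫⁻ η, ‖h η‖ₑ * w g (ξ - η)
  have hF₁ := eLpNorm_lintegral_mul_sub_le hq hgm.enorm (hwm hhm)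
  have hF₂ := eLpNorm_lintegral_mul_sub_le hq hhm.enorm (hwm hgm)
  have m₁ : AEMeasurable F₁ := (hgm.enorm.comp_snd.mul ((hwm hhm).comp_quasiMeasurePreserving
    (quasiMeasurePreserving_sub_of_right_invariant volume volume))).lintegral_prod_right'
  have m₂ : AEMeasurable F₂ := (hhm.enorm.comp_snd.mul ((hwm hgm).comp_quasiMeasurePreserving
    (quasiMeasurePreserving_sub_of_right_invariant volume volume))).lintegral_prod_right'
  -- The weight at `ξ` is distributed over `η` and `ξ - η`, leaving two convolutions of an `L¹`
  -- function with a weighted `L^q` function, to which Young applies.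
  have hle : ∀ ξ, w (g ⋆[mul ℂ ℂ] h) ξ ≤ ENNReal.ofReal (4 ^ (s / 2)) * (F₁ ξ + F₂ ξ) := by
    intro ξ
    have hF₂' : F₂ ξ = ∫⁻ η, w g η * ‖h (ξ - η)‖ₑ := by
      rw [← lintegral_sub_left_eq_self _ ξ]
      simp [F₂, mul_comm]
    have hmm : AEMeasurable fun η => ‖g η‖ₑ * w h (ξ - η) :=
      hgm.enorm.mul ((hwm hhm).comp_quasiMeasurePreserving
        (quasiMeasurePreserving_sub_left_of_right_invariant volume ξ))
    rw [hF₂', ← lintegral_add_left' hmm,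
      ← lintegral_const_mul' _ _ ENNReal.ofReal_ne_top]
    have e1 : w (g ⋆[mul ℂ ℂ] h) ξ = ‖japanese ξ ^ s‖ₑ * ‖∫ η, g η * h (ξ - η)‖ₑ := by
      simp [w, convolution_def, enorm_mul]
    rw [e1]
    refine (mul_le_mul_right (enorm_integral_le_lintegral_enorm _) _).trans ?_
    rw [← lintegral_const_mul' _ _ enorm_ne_top]
    refine lintegral_mono fun η => ?_
    have p : ∀ ζ : Rn n, 0 ≤ japanese ζ ^ s := fun ζ =>
      (Real.rpow_pos_of_pos (japanese_pos _) _).le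
    have h3 : ‖japanese ξ ^ s‖ₑ ≤ ENNReal.ofReal (4 ^ (s / 2)) *
        (‖japanese η ^ s‖ₑ + ‖japanese (ξ - η) ^ s‖ₑ) := by
      rw [Real.enorm_of_nonneg (p _), Real.enorm_of_nonneg (p _), Real.enorm_of_nonneg (p _),
        ← ENNReal.ofReal_add (p _) (p _), ← ENNReal.ofReal_mul (by positivity)]
      exact ENNReal.ofReal_le_ofReal (japanese_rpow_le_add hs0 ξ η)
    calc ‖japanese ξ ^ s‖ₑ * ‖g η * h (ξ - η)‖ₑ
        ≤ ENNReal.ofReal (4 ^ (s / 2)) * (‖japanese η ^ s‖ₑ + ‖japanese (ξ - η) ^ s‖ₑ)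
          * ‖g η * h (ξ - η)‖ₑ := by gcongr
      _ = _ := by
        simp only [w, enorm_mul, enorm_norm]
        ring
  have hfin : eLpNorm (fun ξ => ENNReal.ofReal (4 ^ (s / 2)) * (F₁ ξ + F₂ ξ))
      (ENNReal.ofReal q) volume < ∞ := by
    have h1 : eLpNorm (F₁ + F₂) (ENNReal.ofReal q) volume < ∞ := by
      refine lt_of_le_of_lt (eLpNorm_add_le m₁.aestronglyMeasurable m₂.aestronglyMeasurable
        (by simpa using hq.le)) (ENNReal.add_lt_top.2 ⟨hF₁.trans_lt ?_, hF₂.trans_lt ?_⟩)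
      · rw [← hw]
        exact ENNReal.mul_lt_top hgi.2 hh
      · rw [← hw]
        exact ENNReal.mul_lt_top hhi.2 hg
    refine lt_of_le_of_lt (eLpNorm_le_nnreal_smul_eLpNorm_of_ae_le_mul'
      (c := ((4 : ℝ) ^ (s / 2)).toNNReal) (g := F₁ + F₂)
      (Filter.Eventually.of_forall fun ξ => ?_) _) (ENNReal.mul_lt_top ENNReal.coe_lt_top h1)
    simp [ENNReal.ofReal]
  rw [hw]
  exact lt_of_le_of_lt (eLpNorm_mono_enorm fun ξ => by simpa using hle ξ) hfin

open ContinuousLinearMap Convolution in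
-- The product carries the normalizing constant twice, so one copy remains in front of the
-- convolution.
theorem synth_mul_synth {n : ℕ} (x₀ : Rn n) {g h : Rn n → ℂ} (hg : Integrable g)
    (hh : Integrable h) (x : Rn n) : synth x₀ g x * synth x₀ h x =
      synth x₀ ((((2 * Real.pi) ^ n)⁻¹ : ℝ) • (g ⋆[mul ℂ ℂ] h)) x := by
  have hsm : 𝓕 ((((2 * Real.pi) ^ n)⁻¹ : ℝ) • (g ⋆[mul ℂ ℂ] h)) =
      (((2 * Real.pi) ^ n)⁻¹ : ℝ) • 𝓕 (g ⋆[mul ℂ ℂ] h) := by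
    ext w
    simp only [Real.fourier_eq, Pi.smul_apply]
    rw [← integral_smul]
    congr 1
    ext v
    rw [smul_comm]
  simp only [synth, hsm, Pi.smul_apply, Real.fourier_mul_convolution_eq hg hh]
  simp only [Complex.real_smul]
  ring

theorem synth_add {n : ℕ} (x₀ : Rn n) {g h : Rn n → ℂ} (hg : Integrable g) (hh : Integrable h)
    (x : Rn n) : synth x₀ (g + h) x = synth x₀ g x + synth x₀ h x := by
  have : 𝓕 (g + h) = 𝓕 g + 𝓕 h := by
    exact VectorFourier.fourierIntegral_add Real.continuous_fourierChar
      (L := innerₗ (Rn n)) continuous_inner hg hh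
  simp only [synth, this, Pi.add_apply, smul_add]

theorem synth_smul {n : ℕ} (x₀ : Rn n) (c : ℂ) (g : Rn n → ℂ) (x : Rn n) :
    synth x₀ (c • g) x = c * synth x₀ g x := by
  have : 𝓕 (c • g) = c • 𝓕 g := by
    exact VectorFourier.fourierIntegral_const_smul _ _ _ _ _
  simp only [synth, this, Pi.smul_apply, smul_eq_mul, mul_smul_comm]

theorem weightedNorm_smul {n : ℕ} (q s : ℝ) (c : ℂ) (g : Rn n → ℂ) :
    weightedNorm q s (c • g) = ‖c‖ₑ * weightedNorm q s g := by
  unfold weightedNorm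
  rw [← enorm_norm c, ← eLpNorm_const_smul]
  congr 1
  ext ξ
  simp
  ring

theorem weightedNorm_add_le {n : ℕ} {q : ℝ} (hq : 1 < q) (s : ℝ) {g h : Rn n → ℂ}
    (hg : AEStronglyMeasurable g volume) (hh : AEStronglyMeasurable h volume) :
    weightedNorm q s (g + h) ≤ weightedNorm q s g + weightedNorm q s h := by
  refine le_trans (eLpNorm_mono_real fun ξ => ?_) (eLpNorm_add_le
    ((continuous_japanese_rpow s).aestronglyMeasurable.mul hg.norm)
    ((continuous_japanese_rpow s).aestronglyMeasurable.mul hh.norm) (by simpa using hq.le))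
  have p := Real.rpow_pos_of_pos (japanese_pos ξ) s
  simp only [Pi.add_apply]
  rw [norm_mul, norm_norm, Real.norm_of_nonneg p.le, ← mul_add]
  gcongr
  exact norm_add_le _ _

theorem weightedNorm_zero {n : ℕ} (q s : ℝ) : weightedNorm q s (0 : Rn n → ℂ) = 0 := by
  simp [weightedNorm]

theorem weightedNorm_lt_top_of_hasCompactSupport {n : ℕ} (q s : ℝ) {g : Rn n → ℂ}
    (hg : Continuous g) (hc : HasCompactSupport g) : weightedNorm q s g < ∞ := by
  have h1 : Continuous fun ξ : Rn n => japanese ξ ^ s * ‖g ξ‖ :=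
    (continuous_japanese_rpow s).mul hg.norm
  exact (h1.memLp_of_hasCompactSupport (hc.norm.mul_left)).2

theorem synth_self {n : ℕ} (x₀ : Rn n) (g : Rn n → ℂ) :
    synth x₀ g x₀ = (((2 * Real.pi) ^ n)⁻¹ : ℝ) • ∫ ξ, g ξ := by
  simp [synth, Real.fourier_eq]

/-! ### The algebra structure of `FL` -/

section Algebra

variable {n : ℕ} {q q' s : ℝ}

theorem mul_mem_FL (hq : 1 < q) (hqq' : 1 / q + 1 / q' = 1) (hs : n / q' < s)
    {f g : C(Rn n, ℂ)} (hf : f ∈ FL n q s) (hg : g ∈ FL n q s) : f * g ∈ FL n q s := by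
  rw [mem_FL_iff hq hqq' hs 0] at hf hg ⊢
  obtain ⟨u, hum, hu, hfu⟩ := hf
  obtain ⟨v, hvm, hv, hgv⟩ := hg
  have hui := integrable_of_weighted hq hqq' hs hum hu
  have hvi := integrable_of_weighted hq hqq' hs hvm hv
  have hw := weightedNorm_convolution_lt_top hq hqq' hs hum hu hvm hv
  refine ⟨(((2 * Real.pi) ^ n)⁻¹ : ℝ) • convolution u v (ContinuousLinearMap.mul ℂ ℂ) volume,
    ?_, ?_, fun x => by rw [ContinuousMap.mul_apply, hfu, hgv, synth_mul_synth 0 hui hvi]⟩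
  · exact (hui.integrable_convolution _ hvi).1.const_smul _
  · rw [show (((2 * Real.pi) ^ n)⁻¹ : ℝ) • convolution u v (ContinuousLinearMap.mul ℂ ℂ) volume =
      ((((2 * Real.pi) ^ n)⁻¹ : ℝ) : ℂ) • convolution u v (ContinuousLinearMap.mul ℂ ℂ) volume by
        ext; simp]
    rw [weightedNorm_smul]
    exact ENNReal.mul_lt_top enorm_lt_top hw

theorem add_mem_FL (hq : 1 < q) (hqq' : 1 / q + 1 / q' = 1) (hs : n / q' < s)
    {f g : C(Rn n, ℂ)} (hf : f ∈ FL n q s) (hg : g ∈ FL n q s) : f + g ∈ FL n q s := by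
  rw [mem_FL_iff hq hqq' hs 0] at hf hg ⊢
  obtain ⟨u, hum, hu, hfu⟩ := hf
  obtain ⟨v, hvm, hv, hgv⟩ := hg
  have hui := integrable_of_weighted hq hqq' hs hum hu
  have hvi := integrable_of_weighted hq hqq' hs hvm hv
  exact ⟨u + v, hum.add hvm,
    (weightedNorm_add_le hq s hum hvm).trans_lt (ENNReal.add_lt_top.2 ⟨hu, hv⟩),
    fun x => by rw [ContinuousMap.add_apply, hfu, hgv, synth_add 0 hui hvi]⟩

theorem smul_mem_FL (hq : 1 < q) (hqq' : 1 / q + 1 / q' = 1) (hs : n / q' < s) (c : ℂ)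
    {f : C(Rn n, ℂ)} (hf : f ∈ FL n q s) : c • f ∈ FL n q s := by
  rw [mem_FL_iff hq hqq' hs 0] at hf ⊢
  obtain ⟨u, hum, hu, hfu⟩ := hf
  exact ⟨c • u, hum.const_smul c,
    by rw [weightedNorm_smul]; exact ENNReal.mul_lt_top enorm_lt_top hu,
    fun x => by rw [ContinuousMap.smul_apply, hfu, synth_smul, smul_eq_mul]⟩

theorem zero_mem_FL (hq : 1 < q) (hqq' : 1 / q + 1 / q' = 1) (hs : n / q' < s) :
    (0 : C(Rn n, ℂ)) ∈ FL n q s := by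
  rw [mem_FL_iff hq hqq' hs 0]
  refine ⟨0, aestronglyMeasurable_zero, by simp [weightedNorm_zero], fun x => ?_⟩
  simp [synth, Real.fourier_eq]

theorem sub_mem_FL (hq : 1 < q) (hqq' : 1 / q + 1 / q' = 1) (hs : n / q' < s)
    {f g : C(Rn n, ℂ)} (hf : f ∈ FL n q s) (hg : g ∈ FL n q s) : f - g ∈ FL n q s := by
  have h : f - g = f + (-1 : ℂ) • g := by ext; simp [sub_eq_add_neg]
  exact h ▸ add_mem_FL hq hqq' hs hf (smul_mem_FL hq hqq' hs (-1) hg)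

end Algebra

/-! ### Continuity of the value and the derivative at a point -/

section Evaluation

variable {n : ℕ} {q q' s : ℝ}

theorem eq_zero_of_forall_le_mul {a C : ℝ≥0∞} (hC : C ≠ ∞)
    (h : ∀ ε : ℝ≥0∞, 0 < ε → a ≤ C * ε) : a = 0 := by
  have ht : Filter.Tendsto (fun ε : ℝ≥0∞ => C * ε) (𝓝[>] 0) (𝓝 (C * 0)) :=
    (ENNReal.Tendsto.const_mul Filter.tendsto_id (Or.inr hC)).mono_left nhdsWithin_le_nhds
  rw [mul_zero] at ht
  refine le_antisymm (ge_of_tendsto ht ?_) zero_le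
  filter_upwards [self_mem_nhdsWithin] with ε hε using h ε hε

/-- The value at `x₀` is a multiple of `∫ g`, and the `L¹` norm of `g` is controlled by its weighted
norm. -/
theorem exists_enorm_apply_le (hq : 1 < q) (hqq' : 1 / q + 1 / q' = 1) (hs : n / q' < s)
    (x₀ : Rn n) : ∃ C : ℝ≥0∞, C ≠ ∞ ∧ ∀ (f : C(Rn n, ℂ)) (ε : ℝ≥0∞), flNorm q s f < ε →
      ‖f x₀‖ₑ ≤ C * ε := by
  obtain ⟨C, hC, h⟩ := exists_eLpNorm_one_le_mul_weightedNorm (n := n) hq hqq' hs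
  refine ⟨‖(((2 * Real.pi) ^ n)⁻¹ : ℝ)‖ₑ * C, ENNReal.mul_ne_top enorm_ne_top hC,
    fun f ε hf => ?_⟩
  obtain ⟨g, hm, hg, hfg⟩ := (flNorm_lt_iff hq hqq' hs x₀).1 hf
  rw [hfg, synth_self, enorm_smul, mul_assoc]
  refine mul_le_mul_right ((enorm_integral_le_lintegral_enorm _).trans ?_) _
  rw [← eLpNorm_one_eq_lintegral_enorm]
  exact (h g hm).trans (mul_le_mul_right hg.le _)

/-- Trades one power of the weight for a factor `⟨ξ⟩`, so that the `L¹` bounds at level `s - 1`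
control first derivatives. -/
theorem weightedNorm_japanese_mul (q s : ℝ) (g : Rn n → ℂ) :
    weightedNorm q (s - 1) (fun ξ => (japanese ξ : ℂ) * g ξ) = weightedNorm q s g := by
  unfold weightedNorm
  congr 1
  ext ξ
  have h0 := japanese_pos ξ
  rw [norm_mul, Complex.norm_real, Real.norm_of_nonneg h0.le, ← mul_assoc]
  congr 1
  nth_rw 2 [← Real.rpow_one (japanese ξ)]
  rw [← Real.rpow_add h0]
  congr 1
  ring

theorem aestronglyMeasurable_japanese_mul {g : Rn n → ℂ} (hm : AEStronglyMeasurable g volume) :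
    AEStronglyMeasurable (fun ξ => (japanese ξ : ℂ) * g ξ) volume := by
  have h := continuous_japanese_rpow (n := n) 1
  simp only [Real.rpow_one] at h
  exact (Complex.continuous_ofReal.comp h).aestronglyMeasurable.mul hm

theorem norm_mul_norm_le_japanese_mul (g : Rn n → ℂ) (ξ : Rn n) :
    ‖ξ‖ * ‖g ξ‖ ≤ ‖(japanese ξ : ℂ) * g ξ‖ := by
  rw [norm_mul, Complex.norm_real, Real.norm_of_nonneg (japanese_pos ξ).le]
  exact mul_le_mul_of_nonneg_right (norm_le_japanese ξ) (norm_nonneg _)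

theorem integrable_norm_mul_norm (hq : 1 < q) (hqq' : 1 / q + 1 / q' = 1) (hs : n / q' + 1 < s)
    {g : Rn n → ℂ} (hm : AEStronglyMeasurable g volume) (hg : weightedNorm q s g < ∞) :
    Integrable fun ξ => ‖ξ‖ * ‖g ξ‖ := by
  have h := integrable_of_weighted hq hqq' (s := s - 1) (by linarith)
    (aestronglyMeasurable_japanese_mul hm) (by rwa [weightedNorm_japanese_mul])
  refine h.mono (continuous_norm.aestronglyMeasurable.mul hm.norm)
    (Filter.Eventually.of_forall fun ξ => ?_)
  rw [Real.norm_of_nonneg (by positivity)]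
  exact norm_mul_norm_le_japanese_mul g ξ

/-- The derivative of `synth x₀ g` at `x₀`. -/
noncomputable def synthFDeriv (g : Rn n → ℂ) : Rn n →L[ℝ] ℂ :=
  (((2 * Real.pi) ^ n)⁻¹ : ℝ) •
    ((∫ ξ, VectorFourier.fourierSMulRight (innerSL ℝ) g ξ).comp
      (-((2 * Real.pi)⁻¹ • ContinuousLinearMap.id ℝ (Rn n))))

theorem hasFDerivAt_synth (x₀ : Rn n) {g : Rn n → ℂ} (hi : Integrable g)
    (hi' : Integrable fun ξ => ‖ξ‖ * ‖g ξ‖) : HasFDerivAt (synth x₀ g) (synthFDeriv g) x₀ := by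
  -- At `x₀` the phase is trivial, so the derivative is a plain integral.
  have h0 : (∫ ξ, VectorFourier.fourierSMulRight (innerSL ℝ) g ξ) =
      𝓕 (VectorFourier.fourierSMulRight (innerSL ℝ) g) ((2 * Real.pi)⁻¹ • (x₀ - x₀)) := by
    simp [Real.fourier_eq]
  have h1 := Real.hasFDerivAt_fourier hi hi' ((2 * Real.pi)⁻¹ • (x₀ - x₀))
  rw [← h0] at h1
  have h2 : HasFDerivAt (fun x : Rn n => (2 * Real.pi)⁻¹ • (x₀ - x))
      (-((2 * Real.pi)⁻¹ • ContinuousLinearMap.id ℝ (Rn n))) x₀ := by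
    have := ((hasFDerivAt_id (𝕜 := ℝ) x₀).const_sub x₀).const_smul (2 * Real.pi)⁻¹
    rwa [smul_neg] at this
  exact (h1.comp x₀ h2).const_smul (((2 * Real.pi) ^ n)⁻¹ : ℝ)

theorem synthFDeriv_apply {g : Rn n → ℂ} (hi : Integrable g)
    (hi' : Integrable fun ξ => ‖ξ‖ * ‖g ξ‖) (y : Rn n) :
    synthFDeriv g y = (((2 * Real.pi) ^ n)⁻¹ : ℝ) •
      (Complex.I * ∫ ξ, (inner ℝ ξ y : ℂ) * g ξ) := by
  have hint : Integrable (VectorFourier.fourierSMulRight (innerSL ℝ) g) := by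
    refine (hi'.const_mul (2 * Real.pi * ‖innerSL (E := Rn n) ℝ‖)).mono'
      hi.1.fourierSMulRight (Filter.Eventually.of_forall fun ξ => ?_)
    have := VectorFourier.norm_fourierSMulRight_le (innerSL (E := Rn n) ℝ) g ξ
    linarith
  simp only [synthFDeriv, smul_apply, ContinuousLinearMap.comp_apply,
    neg_apply, ContinuousLinearMap.id_apply]
  rw [ContinuousLinearMap.integral_apply hint, ← integral_const_mul]
  congr 2
  ext ξ
  have hp : (Real.pi : ℂ) ≠ 0 := by exact_mod_cast Real.pi_ne_zero
  simp [VectorFourier.fourierSMulRight_apply]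
  field_simp
  rw [mul_comm]
  rfl

/-- The derivative at `x₀` is bounded by `∫ ‖ξ‖ ‖g‖ ≤ ∫ ⟨ξ⟩ ‖g‖`, up to a constant, and Hölder
applies to `⟨ξ⟩ g` because `s - 1 > n / q'`. -/
theorem exists_enorm_fderiv_le (hq : 1 < q) (hqq' : 1 / q + 1 / q' = 1) (hs : n / q' + 1 < s)
    (x₀ : Rn n) : ∃ C : ℝ≥0∞, C ≠ ∞ ∧ ∀ (f : C(Rn n, ℂ)) (ε : ℝ≥0∞), flNorm q s f < ε →
      ‖fderiv ℝ f x₀‖ₑ ≤ C * ε := by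
  have hs' : n / q' < s - 1 := by linarith
  have hs'' : n / q' < s := by linarith
  obtain ⟨C, hC, h⟩ := exists_eLpNorm_one_le_mul_weightedNorm (n := n) hq hqq' hs'
  let T : Rn n →L[ℝ] Rn n := -((2 * Real.pi)⁻¹ • ContinuousLinearMap.id ℝ (Rn n))
  let K : ℝ≥0∞ := ‖(((2 * Real.pi) ^ n)⁻¹ : ℝ)‖ₑ * (‖2 * Real.pi * ‖innerSL (E := Rn n) ℝ‖‖ₑ * ‖T‖ₑ)
  refine ⟨K * C, by finiteness, fun f ε hf => ?_⟩
  obtain ⟨g, hm, hg, hfg⟩ := (flNorm_lt_iff hq hqq' hs'' x₀).1 hf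
  have hg' := hg.trans_le le_top
  have hi := integrable_of_weighted hq hqq' hs'' hm hg'
  have hi' := integrable_norm_mul_norm hq hqq' hs hm hg'
  have hd : fderiv ℝ f x₀ = synthFDeriv g := by
    rw [show (f : Rn n → ℂ) = synth x₀ g from funext hfg]
    exact (hasFDerivAt_synth x₀ hi hi').fderiv
  have h1 : eLpNorm (fun ξ => (japanese ξ : ℂ) * g ξ) 1 volume ≤ C * ε := by
    refine (h _ (aestronglyMeasurable_japanese_mul hm)).trans ?_
    rw [weightedNorm_japanese_mul]
    exact mul_le_mul_right hg.le _
  have h2 : ‖∫ ξ, VectorFourier.fourierSMulRight (innerSL ℝ) g ξ‖ₑ ≤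
      ‖2 * Real.pi * ‖innerSL (E := Rn n) ℝ‖‖ₑ * (C * ε) := by
    refine (enorm_integral_le_lintegral_enorm _).trans ?_
    refine le_trans ?_ (mul_le_mul_right h1 _)
    rw [eLpNorm_one_eq_lintegral_enorm, ← lintegral_const_mul' _ _ enorm_ne_top]
    refine lintegral_mono fun ξ => ?_
    rw [← enorm_norm ((japanese ξ : ℂ) * g ξ), ← enorm_mul, enorm_le_iff_norm_le, norm_mul,
      norm_norm, Real.norm_of_nonneg (by positivity)]
    have h3 := VectorFourier.norm_fourierSMulRight_le (innerSL (E := Rn n) ℝ) g ξ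
    have h4 := norm_mul_norm_le_japanese_mul g ξ
    have h5 : 0 ≤ 2 * Real.pi * ‖innerSL (E := Rn n) ℝ‖ := by positivity
    nlinarith
  rw [hd, synthFDeriv, enorm_smul]
  calc _ ≤ ‖(((2 * Real.pi) ^ n)⁻¹ : ℝ)‖ₑ *
        (‖∫ ξ, VectorFourier.fourierSMulRight (innerSL ℝ) g ξ‖ₑ * ‖T‖ₑ) := by
        refine mul_le_mul_right ?_ _
        rw [← enorm_norm, ← enorm_norm (∫ ξ, _), ← enorm_norm T, ← enorm_mul,
          enorm_le_iff_norm_le, norm_norm, Real.norm_of_nonneg (by positivity)]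
        exact ContinuousLinearMap.opNorm_comp_le _ _
    _ ≤ ‖(((2 * Real.pi) ^ n)⁻¹ : ℝ)‖ₑ *
        (‖2 * Real.pi * ‖innerSL (E := Rn n) ℝ‖‖ₑ * (C * ε) * ‖T‖ₑ) := by gcongr
    _ = K * C * ε := by simp only [K]; ring

theorem differentiableAt_of_mem_FL (hq : 1 < q) (hqq' : 1 / q + 1 / q' = 1)
    (hs : n / q' + 1 < s) (x₀ : Rn n) {f : C(Rn n, ℂ)} (hf : f ∈ FL n q s) :
    DifferentiableAt ℝ f x₀ := by
  have hs' : n / q' < s := by linarith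
  obtain ⟨g, hm, hg, hfg⟩ := (mem_FL_iff hq hqq' hs' x₀).1 hf
  rw [show (f : Rn n → ℂ) = synth x₀ g from funext hfg]
  exact (hasFDerivAt_synth x₀ (integrable_of_weighted hq hqq' hs' hm hg)
    (integrable_norm_mul_norm hq hqq' hs hm hg)).differentiableAt

end Evaluation

/-! ### Closed ideals at a point and failure of synthesis -/

section Ideals

variable {n : ℕ} {q q' s : ℝ}

/-- The ideal of functions in `FL^q_s(ℝⁿ)` that vanish at `x₀`. -/
def pointIdeal (hq : 1 < q) (hqq' : 1 / q + 1 / q' = 1) (hs : n / q' < s) (x₀ : Rn n) :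
    Submodule ℂ C(Rn n, ℂ) where
  carrier := {f | f ∈ FL n q s ∧ f x₀ = 0}
  add_mem' := fun ha hb => ⟨add_mem_FL hq hqq' hs ha.1 hb.1, by simp [ha.2, hb.2]⟩
  zero_mem' := ⟨zero_mem_FL hq hqq' hs, rfl⟩
  smul_mem' := fun c _ ha => ⟨smul_mem_FL hq hqq' hs c ha.1, by simp [ha.2]⟩

/-- `pointIdeal` is itself one of the closed ideals being intersected, since evaluation at `x₀` is
continuous. -/
theorem closedIdealNear_subset_vanishingIdeal (hq : 1 < q) (hqq' : 1 / q + 1 / q' = 1)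
    (hs : n / q' < s) (x₀ : Rn n) : closedIdealNear q s {x₀} ⊆ vanishingIdeal q s {x₀} := by
  rintro f ⟨hf, h⟩
  refine ⟨hf, fun x hx => ?_⟩
  rw [Set.mem_singleton_iff.1 hx]
  refine (h (pointIdeal hq hqq' hs x₀) ⟨fun g hg => hg.1, fun g hg k hk =>
    ⟨mul_mem_FL hq hqq' hs hg hk.1, by simp [hk.2]⟩⟩ (fun g hg hc => ⟨hg, ?_⟩)
    (fun g hg => ⟨hg.1, ?_⟩)).2
  · obtain ⟨C, hC, hb⟩ := exists_enorm_apply_le hq hqq' hs x₀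
    refine enorm_eq_zero.1 (eq_zero_of_forall_le_mul hC fun ε hε => ?_)
    obtain ⟨k, hk, hlt⟩ := hc ε hε
    have := hb _ ε hlt
    rwa [ContinuousMap.sub_apply, hk.2, sub_zero] at this
  · have := hg.2
    rw [nhdsSet_singleton] at this
    exact this.self_of_nhds

/-- The ideal of functions in `FL^q_s(ℝⁿ)` that vanish at `x₀` together with their derivative. -/
def pointIdealSq (hq : 1 < q) (hqq' : 1 / q + 1 / q' = 1) (hs : n / q' + 1 < s) (x₀ : Rn n) :
    Submodule ℂ C(Rn n, ℂ) where
  carrier := {f | f ∈ FL n q s ∧ f x₀ = 0 ∧ HasFDerivAt f (0 : Rn n →L[ℝ] ℂ) x₀}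
  add_mem' := fun ha hb => ⟨add_mem_FL hq hqq' (by linarith) ha.1 hb.1, by simp [ha.2.1, hb.2.1],
    by simpa using ha.2.2.add hb.2.2⟩
  zero_mem' := ⟨zero_mem_FL hq hqq' (by linarith), rfl, hasFDerivAt_const 0 x₀⟩
  smul_mem' := fun c _ ha => ⟨smul_mem_FL hq hqq' (by linarith) c ha.1, by simp [ha.2.1],
    by simpa using ha.2.2.const_smul c⟩

/-- `pointIdealSq` is one of the closed ideals being intersected: the product rule makes it an
ideal, and the bounds on value and derivative make it closed. -/
theorem hasFDerivAt_zero_of_mem_closedIdealNear (hq : 1 < q) (hqq' : 1 / q + 1 / q' = 1)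
    (hs : n / q' + 1 < s) (x₀ : Rn n) {f : C(Rn n, ℂ)} (hf : f ∈ closedIdealNear q s {x₀}) :
    HasFDerivAt f (0 : Rn n →L[ℝ] ℂ) x₀ := by
  have hs' : n / q' < s := by linarith
  refine (hf.2 (pointIdealSq hq hqq' hs x₀) ⟨fun g hg => hg.1, fun g hg k hk =>
    ⟨mul_mem_FL hq hqq' hs' hg hk.1, by simp [hk.2.1], ?_⟩⟩ (fun g hg hc => ⟨hg, ?_, ?_⟩)
    (fun g hg => ?_)).2.2
  · have := (differentiableAt_of_mem_FL hq hqq' hs x₀ hg).hasFDerivAt.mul hk.2.2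
    rw [hk.2.1] at this
    refine this.congr_fderiv ?_
    ext y
    change g x₀ * 0 + 0 * fderiv ℝ g x₀ y = 0
    simp
  · obtain ⟨C, hC, hb⟩ := exists_enorm_apply_le hq hqq' hs' x₀
    refine enorm_eq_zero.1 (eq_zero_of_forall_le_mul hC fun ε hε => ?_)
    obtain ⟨k, hk, hlt⟩ := hc ε hε
    have := hb _ ε hlt
    rwa [ContinuousMap.sub_apply, hk.2.1, sub_zero] at this
  · have hd := (differentiableAt_of_mem_FL hq hqq' hs x₀ hg).hasFDerivAt
    obtain ⟨C, hC, hb⟩ := exists_enorm_fderiv_le hq hqq' hs x₀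
    have : fderiv ℝ g x₀ = 0 := by
      refine norm_eq_zero.1 (enorm_eq_zero.1 ?_)
      rw [enorm_norm]
      refine eq_zero_of_forall_le_mul hC fun ε hε => ?_
      obtain ⟨k, hk, hlt⟩ := hc ε hε
      have h1 := hb _ ε hlt
      have h2 : HasFDerivAt (g - k : C(Rn n, ℂ)) (fderiv ℝ g x₀ - 0) x₀ := hd.sub hk.2.2
      rwa [h2.fderiv, sub_zero] at h1
    rwa [this] at hd
  · have := hg.2
    rw [nhdsSet_singleton] at this
    exact ⟨hg.1, this.self_of_nhds, (hasFDerivAt_const (0 : ℂ) x₀).congr_of_eventuallyEq this⟩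

/-- Take `g ξ = ⟨ξ, e⟩ b ξ` with `e` a unit vector and `b` an even bump. It is odd, so its mean and
hence the value at `x₀` vanish; the derivative along `e` is a nonzero multiple of `∫ ⟨ξ, e⟩² b > 0`.
-/
theorem exists_mem_vanishingIdeal_not_hasFDerivAt_zero (hn : 1 ≤ n) (hq : 1 < q)
    (hqq' : 1 / q + 1 / q' = 1) (hs : n / q' + 1 < s) (x₀ : Rn n) :
    ∃ f ∈ vanishingIdeal q s {x₀}, ¬ HasFDerivAt f (0 : Rn n →L[ℝ] ℂ) x₀ := by
  have hs' : n / q' < s := by linarith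
  let b : ContDiffBump (0 : Rn n) := ⟨1, 2, one_pos, one_lt_two⟩
  let e : Rn n := EuclideanSpace.single ⟨0, hn⟩ 1
  have he : ‖e‖ = 1 := by simp [e]
  let g : Rn n → ℂ := fun ξ => ((inner ℝ ξ e * b ξ : ℝ) : ℂ)
  have hbc := b.continuous
  have hgc : Continuous g := by fun_prop
  have hgs : HasCompactSupport g := by
    have h1 : HasCompactSupport fun ξ : Rn n => inner ℝ ξ e * b ξ := b.hasCompactSupport.mul_left
    exact h1.comp_left (g := ((↑) : ℝ → ℂ)) Complex.ofReal_zero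
  have hgw := weightedNorm_lt_top_of_hasCompactSupport q s hgc hgs
  have hgm : AEStronglyMeasurable g volume := hgc.aestronglyMeasurable
  have hi := integrable_of_weighted hq hqq' hs' hgm hgw
  have hi' := integrable_norm_mul_norm hq hqq' hs hgm hgw
  let f : C(Rn n, ℂ) := ⟨synth x₀ g, continuous_synth x₀ hi⟩
  have hodd : ∫ ξ, g ξ = 0 := by
    have h1 : ∀ ξ, g (-ξ) = -g ξ := fun ξ => by simp [g, b.neg]
    have h2 := integral_neg_eq_self g volume
    simp only [h1, integral_neg] at h2
    exact self_eq_neg.1 h2.symm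
  refine ⟨f, ⟨(mem_FL_iff hq hqq' hs' x₀).2 ⟨g, hgm, hgw, fun x => rfl⟩, fun x hx => ?_⟩, fun h => ?_⟩
  · rw [Set.mem_singleton_iff.1 hx]
    change synth x₀ g x₀ = 0
    rw [synth_self, hodd, smul_zero]
  · have h1 : synthFDeriv g = 0 := (hasFDerivAt_synth x₀ hi hi').unique h
    have h2 := synthFDeriv_apply hi hi' e
    have h3 : 0 < ∫ ξ : Rn n, inner ℝ ξ e * (inner ℝ ξ e * b ξ) := by
      refine Continuous.integral_pos_of_hasCompactSupport_nonneg_nonzero (x := e) (by fun_prop)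
        (b.hasCompactSupport.mul_left.mul_left) (fun ξ => ?_) ?_
      · have := mul_nonneg (mul_self_nonneg (inner ℝ ξ e)) (b.nonneg' ξ)
        simpa [mul_assoc] using this
      · rw [b.one_of_mem_closedBall (by simp [he, b])]
        simp [he]
    have h4 : ∫ ξ, (inner ℝ ξ e : ℂ) * g ξ =
        ((∫ ξ : Rn n, inner ℝ ξ e * (inner ℝ ξ e * b ξ) : ℝ) : ℂ) := by
      rw [← integral_complex_ofReal]
      simp [g]
    have hp : (Real.pi : ℂ) ≠ 0 := by exact_mod_cast Real.pi_ne_zero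
    rw [h1, h4] at h2
    simp [hp] at h2
    simp [h2] at h3

end Ideals

/-! ### Cut-off estimates below the threshold -/

theorem exists_norm_sub_le_of_schwartz {n : ℕ} (Φ : 𝓢(Rn n, ℂ)) (N : ℕ) :
    ∃ C : ℝ, 0 ≤ C ∧ ∀ a h : Rn n, ‖h‖ ≤ 1 →
      ‖Φ (a - h) - Φ a‖ ≤ C * ‖h‖ * ((1 + ‖a‖) ^ N)⁻¹ := by
  obtain ⟨K, hK⟩ : ∃ K : ℝ, ∀ x : Rn n, (1 + ‖x‖) ^ N * ‖fderiv ℝ Φ x‖ ≤ K := by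
    refine ⟨2 ^ N * (Finset.Iic (N, 1)).sup (fun m => SchwartzMap.seminorm ℝ m.1 m.2) Φ,
      fun x => ?_⟩
    have := SchwartzMap.one_add_le_sup_seminorm_apply (𝕜 := ℝ) (m := (N, 1)) le_rfl le_rfl Φ x
    rwa [norm_iteratedFDeriv_one] at this
  have hK0 : 0 ≤ K := le_trans (by positivity) (hK 0)
  refine ⟨2 ^ N * K, by positivity, fun a h hh => ?_⟩
  have hb : ∀ x ∈ Metric.closedBall a 1, ‖fderiv ℝ Φ x‖ ≤ 2 ^ N * K * ((1 + ‖a‖) ^ N)⁻¹ := by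
    intro x hx
    rw [mem_closedBall_iff_norm] at hx
    -- Within distance 1 of `a` the decay factor changes by at most `2 ^ N`, so the mean value
    -- inequality keeps the decay in `a`.
    have h1 : 1 + ‖a‖ ≤ 2 * (1 + ‖x‖) := by
      have := norm_sub_norm_le a x
      rw [norm_sub_rev] at this
      linarith [norm_nonneg x]
    rw [← div_eq_mul_inv, le_div_iff₀ (by positivity)]
    calc ‖fderiv ℝ Φ x‖ * (1 + ‖a‖) ^ N ≤ ‖fderiv ℝ Φ x‖ * (2 * (1 + ‖x‖)) ^ N := by gcongr
      _ = 2 ^ N * ((1 + ‖x‖) ^ N * ‖fderiv ℝ Φ x‖) := by rw [mul_pow]; ring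
      _ ≤ 2 ^ N * K := by gcongr; exact hK x
  have := (convex_closedBall a 1).norm_image_sub_le_of_norm_fderiv_le
    (fun x _ => Φ.differentiableAt) hb (Metric.mem_closedBall_self zero_le_one)
    (y := a - h) (by simpa [mem_closedBall_iff_norm] using hh)
  have e : ‖a - h - a‖ = ‖h‖ := by rw [sub_sub_cancel_left, norm_neg]
  rw [e] at this
  linarith

theorem eLpNorm_comp_smul {n : ℕ} {q : ℝ} (hq : 0 < q) {F : Rn n → ℝ} (hF : Continuous F)
    {ε : ℝ} (hε : 0 < ε) : eLpNorm (fun ξ => F (ε • ξ)) (ENNReal.ofReal q) volume =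
      ENNReal.ofReal (ε ^ (-(n / q))) * eLpNorm F (ENNReal.ofReal q) volume := by
  have h1 : eLpNorm (fun ξ => F (ε • ξ)) (ENNReal.ofReal q) volume =
      eLpNorm F (ENNReal.ofReal q) (Measure.map (fun ξ : Rn n => ε • ξ) volume) :=
    (eLpNorm_map_measure hF.aestronglyMeasurable (by fun_prop)).symm
  rw [h1, Measure.map_addHaar_smul _ hε.ne', eLpNorm_smul_measure_of_ne_top (by simp),
    finrank_euclideanSpace, Fintype.card_fin, smul_eq_mul, abs_of_pos (by positivity),
    one_div, ENNReal.toReal_inv, ENNReal.toReal_ofReal hq.le,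
    ENNReal.ofReal_rpow_of_pos (by positivity)]
  congr 2
  rw [← Real.rpow_natCast, ← Real.rpow_neg hε.le, ← Real.rpow_mul hε.le]
  congr 1
  ring

theorem exists_eLpNorm_japanese_mul_le {n : ℕ} {q s : ℝ} (hq : 0 < q) (hs : 0 ≤ s) :
    ∃ (N : ℕ) (M : ℝ≥0∞), M ≠ ∞ ∧ ∀ ε : ℝ, 0 < ε → ε ≤ 1 →
      eLpNorm (fun ξ : Rn n => japanese ξ ^ s * ((1 + ‖ε • ξ‖) ^ N)⁻¹) (ENNReal.ofReal q) volume ≤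
        ENNReal.ofReal (ε ^ (-s - n / q)) * M := by
  -- This makes `(1 + ‖ξ‖) ^ (s - N)` belong to `L^q`.
  obtain ⟨N, hN⟩ := exists_nat_gt (s + n / q)
  let F : Rn n → ℝ := fun ξ => (1 + ‖ξ‖) ^ (s - N)
  have hb : Continuous fun ξ : Rn n => 1 + ‖ξ‖ := by fun_prop
  have hF : Continuous F := hb.rpow_const fun ξ => Or.inl (by positivity)
  have hM : MemLp F (ENNReal.ofReal q) volume := by
    rw [← integrable_norm_rpow_iff hF.aestronglyMeasurable (by simpa using hq) (by simp)]
    have h : (n : ℝ) < (N - s) * q := by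
      rw [← div_lt_iff₀ hq]
      linarith
    refine (integrable_one_add_norm (E := Rn n) (r := (N - s) * q) (by simpa using h)).congr
      (Filter.Eventually.of_forall fun ξ => ?_)
    simp only [F, ENNReal.toReal_ofReal hq.le]
    rw [Real.norm_of_nonneg (by positivity), ← Real.rpow_mul (by positivity)]
    congr 1
    ring
  refine ⟨N, _, hM.2.ne, fun ε hε hε1 => ?_⟩
  rw [sub_eq_add_neg, Real.rpow_add hε, ENNReal.ofReal_mul (by positivity), mul_assoc,
    ← eLpNorm_comp_smul hq hF hε]
  have e : ENNReal.ofReal (ε ^ (-s)) = ‖ε ^ (-s)‖ₑ := (Real.enorm_of_nonneg (by positivity)).symm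
  rw [e, ← eLpNorm_const_smul]
  refine eLpNorm_mono_real fun ξ => ?_
  have hj := japanese_pos ξ
  rw [Real.norm_of_nonneg (by positivity)]
  -- For `ε ≤ 1` the weight costs `ε^(-s)` after rescaling; the change of variables costs
  -- `ε^(-n/q)`.
  have h1 : japanese ξ ≤ ε⁻¹ * (1 + ‖ε • ξ‖) := by
    rw [norm_smul, Real.norm_of_nonneg hε.le, mul_add, inv_mul_cancel_left₀ hε.ne', mul_one]
    have := (one_le_inv₀ hε).2 hε1
    linarith [japanese_le_one_add_norm ξ]
  have h2 : japanese ξ ^ s ≤ ε ^ (-s) * (1 + ‖ε • ξ‖) ^ s := by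
    refine (Real.rpow_le_rpow hj.le h1 hs).trans (le_of_eq ?_)
    rw [Real.mul_rpow (by positivity) (by positivity), Real.inv_rpow hε.le, Real.rpow_neg hε.le]
  simp only [Pi.smul_apply, smul_eq_mul, F]
  rw [Real.rpow_sub (by positivity), Real.rpow_natCast, div_eq_mul_inv, ← mul_assoc]
  gcongr

open ContinuousLinearMap Convolution in
/-- Convolving a function of mean zero with the kernel `εⁿ Φ(ε ·)` of a dilated cut-off function
gives a function whose norm in `L^q_s` tends to zero if `s < n / q' + 1`. -/
theorem tendsto_weightedNorm_convolution {n : ℕ} {q q' s : ℝ} (hq : 1 < q)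
    (hqq' : 1 / q + 1 / q' = 1) (hs0 : 0 ≤ s) (hs : s < n / q' + 1) (Φ : 𝓢(Rn n, ℂ))
    {g : Rn n → ℂ} (hg : Continuous g) (hgc : HasCompactSupport g) (hg0 : ∫ ξ, g ξ = 0) :
    Filter.Tendsto (fun ε : ℝ => weightedNorm q s
      (g ⋆[mul ℂ ℂ] fun ξ => ((ε ^ n : ℝ) : ℂ) * Φ (ε • ξ))) (𝓝[>] 0) (𝓝 0) := by
  have hq0 : 0 < q := by linarith
  obtain ⟨N, M, hM, hbound⟩ := exists_eLpNorm_japanese_mul_le (n := n) hq0 hs0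
  obtain ⟨C, hC0, hC⟩ := exists_norm_sub_le_of_schwartz Φ N
  obtain ⟨R, hR0, hR⟩ : ∃ R : ℝ, 0 < R ∧ ∀ ξ, g ξ ≠ 0 → ‖ξ‖ ≤ R := by
    obtain ⟨R, hR⟩ := hgc.isCompact.isBounded.exists_norm_le
    exact ⟨max R 1, by positivity, fun ξ hξ =>
      (hR ξ (subset_tsupport g hξ)).trans (le_max_left _ _)⟩
  have hgi : Integrable g := hg.integrable_of_hasCompactSupport hgc
  set A : ℝ := ∫ ξ, ‖g ξ‖ with hA
  have hA0 : 0 ≤ A := integral_nonneg fun _ => norm_nonneg _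
  have hpt : ∀ ε : ℝ, 0 < ε → ε * R ≤ 1 → ∀ ξ : Rn n,
      ‖(g ⋆[mul ℂ ℂ] fun ξ => ((ε ^ n : ℝ) : ℂ) * Φ (ε • ξ)) ξ‖ ≤
        (A * C * R * (ε ^ n * ε)) * ((1 + ‖ε • ξ‖) ^ N)⁻¹ := by
    intro ε hε hεR ξ
    obtain ⟨B, hB⟩ := Φ.decay 0 0
    have hint : Integrable fun η => g η * (((ε ^ n : ℝ) : ℂ) * Φ (ε • (ξ - η))) := by
      refine hgi.mul_bdd (c := ε ^ n * B) (by fun_prop)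
        (Filter.Eventually.of_forall fun η => ?_)
      rw [norm_mul, Complex.norm_real, Real.norm_of_nonneg (by positivity)]
      gcongr
      simpa using hB.2 (ε • (ξ - η))
    -- Since `∫ g = 0`, the value at `η = 0` of the kernel can be subtracted. On the support of `g`
    -- the remaining difference is of order `ε R`.
    have e1 : (g ⋆[mul ℂ ℂ] fun ξ => ((ε ^ n : ℝ) : ℂ) * Φ (ε • ξ)) ξ =
        ∫ η, g η * (((ε ^ n : ℝ) : ℂ) * (Φ (ε • ξ - ε • η) - Φ (ε • ξ))) := by
      have h2 : ∫ η, g η * (((ε ^ n : ℝ) : ℂ) * Φ (ε • ξ)) = 0 := by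
        rw [integral_mul_const, hg0, zero_mul]
      rw [convolution_def, ← sub_zero (∫ _, _), ← h2]
      simp only [mul_apply']
      rw [← integral_sub hint (hgi.mul_const _)]
      congr 1
      ext η
      rw [smul_sub]
      ring
    rw [e1]
    have e2 : (A * C * R * (ε ^ n * ε)) * ((1 + ‖ε • ξ‖) ^ N)⁻¹ =
        ∫ η, ‖g η‖ * (C * R * (ε ^ n * ε) * ((1 + ‖ε • ξ‖) ^ N)⁻¹) := by
      rw [integral_mul_const, ← hA]
      ring
    rw [e2]
    refine norm_integral_le_of_norm_le (hgi.norm.mul_const _)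
      (Filter.Eventually.of_forall fun η => ?_)
    by_cases hη : g η = 0
    · simp [hη]
    have h3 : ‖ε • η‖ ≤ ε * R := by
      rw [norm_smul, Real.norm_of_nonneg hε.le]
      exact mul_le_mul_of_nonneg_left (hR η hη) hε.le
    rw [norm_mul, norm_mul, Complex.norm_real, Real.norm_of_nonneg (by positivity)]
    refine mul_le_mul_of_nonneg_left ?_ (norm_nonneg _)
    calc ε ^ n * ‖Φ (ε • ξ - ε • η) - Φ (ε • ξ)‖
        ≤ ε ^ n * (C * (ε * R) * ((1 + ‖ε • ξ‖) ^ N)⁻¹) := by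
          refine mul_le_mul_of_nonneg_left ((hC _ _ (h3.trans hεR)).trans ?_) (by positivity)
          gcongr
      _ = _ := by ring
  have hle : ∀ᶠ ε : ℝ in 𝓝[>] 0, weightedNorm q s
      (g ⋆[mul ℂ ℂ] fun ξ => ((ε ^ n : ℝ) : ℂ) * Φ (ε • ξ)) ≤
        ENNReal.ofReal (A * C * R * ε ^ (n / q' + 1 - s)) * M := by
    filter_upwards [Ioc_mem_nhdsGT (show (0 : ℝ) < min 1 R⁻¹ by positivity)] with ε hε
    have hε0 := hε.1
    have hε1 : ε ≤ 1 := hε.2.trans (min_le_left _ _)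
    have hεR : ε * R ≤ 1 := by
      have := hε.2.trans (min_le_right _ _)
      rwa [← one_div, le_div_iff₀ hR0] at this
    have hK : 0 ≤ A * C * R * (ε ^ n * ε) := by positivity
    -- Exponent count: `n + 1 - s - n/q = n/q' + 1 - s`.
    have e3 : ENNReal.ofReal (A * C * R * ε ^ (n / q' + 1 - s)) =
        ‖A * C * R * (ε ^ n * ε)‖ₑ * ENNReal.ofReal (ε ^ (-s - n / q)) := by
      rw [Real.enorm_of_nonneg hK, ← ENNReal.ofReal_mul hK, mul_assoc (A * C * R)]
      congr 2
      nth_rw 3 [← Real.rpow_one ε]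
      rw [← Real.rpow_natCast, ← Real.rpow_add hε0, ← Real.rpow_add hε0]
      congr 1
      have : (n : ℝ) = n * (1 / q + 1 / q') := by rw [hqq', mul_one]
      rw [mul_add, mul_one_div, mul_one_div] at this
      linarith
    rw [e3, mul_assoc]
    refine le_trans ?_ (mul_le_mul_right (hbound ε hε0 hε1) _)
    rw [← eLpNorm_const_smul]
    refine eLpNorm_mono_real fun ξ => ?_
    have hj := Real.rpow_pos_of_pos (japanese_pos ξ) s
    rw [norm_mul, norm_norm, Real.norm_of_nonneg hj.le, Pi.smul_apply, smul_eq_mul, mul_left_comm]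
    exact mul_le_mul_of_nonneg_left (hpt ε hε0 hεR ξ) hj.le
  refine tendsto_of_tendsto_of_tendsto_of_le_of_le' tendsto_const_nhds ?_
    (Filter.Eventually.of_forall fun _ => zero_le) hle
  have hexp : 0 < n / q' + 1 - s := by linarith
  have h1 : Filter.Tendsto (fun ε : ℝ => A * C * R * ε ^ (n / q' + 1 - s)) (𝓝[>] 0) (𝓝 0) := by
    have := ((Real.continuousAt_rpow_const 0 (n / q' + 1 - s) (Or.inr hexp.le)).tendsto.mono_left
      nhdsWithin_le_nhds).const_mul (A * C * R) (x := 𝓝[>] 0)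
    rwa [Real.zero_rpow hexp.ne', mul_zero] at this
  have h2 := ENNReal.Tendsto.mul_const (ENNReal.tendsto_ofReal h1) (Or.inr hM)
  simpa using h2

/-! ### Density of mean-zero functions and synthesis below the threshold -/

/-- The functions of mean zero that are continuous with compact support are dense in the functions
of mean zero in `L^q_s`. -/
theorem exists_continuous_integral_eq_zero_weightedNorm_sub_lt {n : ℕ} {q q' s : ℝ} (hq : 1 < q)
    (hqq' : 1 / q + 1 / q' = 1) (hs : n / q' < s) {g : Rn n → ℂ}
    (hm : AEStronglyMeasurable g volume) (hg : weightedNorm q s g < ∞) (hg0 : ∫ ξ, g ξ = 0)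
    {δ : ℝ≥0∞} (hδ : 0 < δ) :
    ∃ h : Rn n → ℂ, Continuous h ∧ HasCompactSupport h ∧ ∫ ξ, h ξ = 0 ∧
      weightedNorm q s (g - h) < δ := by
  obtain ⟨C, hC, hCb⟩ := exists_eLpNorm_one_le_mul_weightedNorm (n := n) hq hqq' hs
  let b : ContDiffBump (0 : Rn n) := ⟨1, 2, one_pos, one_lt_two⟩
  let u : Rn n → ℂ := fun ξ => ((b.normed volume ξ : ℝ) : ℂ)
  have huc : Continuous u := Complex.continuous_ofReal.comp b.continuous_normed
  have hus : HasCompactSupport u :=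
    b.hasCompactSupport_normed.comp_left (g := ((↑) : ℝ → ℂ)) Complex.ofReal_zero
  have hu1 : ∫ ξ, u ξ = 1 := by
    simp only [u, integral_complex_ofReal, b.integral_normed, Complex.ofReal_one]
  have huw := weightedNorm_lt_top_of_hasCompactSupport q s huc hus
  have hp : ∀ r : ℝ, Continuous fun ξ : Rn n => ((japanese ξ ^ r : ℝ) : ℂ) := fun r =>
    Complex.continuous_ofReal.comp (continuous_japanese_rpow r)
  have hF : MemLp (fun ξ => ((japanese ξ ^ s : ℝ) : ℂ) * g ξ) (ENNReal.ofReal q) volume := by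
    refine ⟨(hp s).aestronglyMeasurable.mul hm, lt_of_le_of_lt (le_of_eq ?_) hg⟩
    refine eLpNorm_congr_norm_ae (Filter.Eventually.of_forall fun ξ => ?_)
    simp
  -- The total error is `ε` from approximating `g` by `k`, plus at most `C * ε` times the norm of
  -- `u` from restoring mean zero.
  obtain ⟨ε, hε, hεδ⟩ : ∃ ε : ℝ≥0∞, 0 < ε ∧ ε + C * ε * weightedNorm q s u < δ := by
    have ht : Filter.Tendsto (fun ε : ℝ≥0∞ => ε + C * ε * weightedNorm q s u) (𝓝[>] 0)
        (𝓝 (0 + C * 0 * weightedNorm q s u)) := by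
      refine Filter.Tendsto.mono_left ?_ nhdsWithin_le_nhds
      exact Filter.tendsto_id.add (ENNReal.Tendsto.mul_const
        (ENNReal.Tendsto.const_mul Filter.tendsto_id (Or.inr hC)) (Or.inr huw.ne))
    simp only [mul_zero, zero_mul, add_zero] at ht
    obtain ⟨ε, h1, h2⟩ := ((ht.eventually_lt_const hδ).and self_mem_nhdsWithin).exists
    exact ⟨ε, h2, h1⟩
  -- Approximation takes place in unweighted `L^q`, applied to `⟨ξ⟩^s g`; the weight is divided out
  -- afterwards.
  obtain ⟨G, hGs, hGle, hGc, -⟩ := hF.exists_hasCompactSupport_eLpNorm_sub_le (by simp) hε.ne'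
  let k : Rn n → ℂ := fun ξ => ((japanese ξ ^ (-s) : ℝ) : ℂ) * G ξ
  have hkc : Continuous k := (hp (-s)).mul hGc
  have hks : HasCompactSupport k := hGs.mul_left
  have hki : Integrable k := hkc.integrable_of_hasCompactSupport hks
  have hgi := integrable_of_weighted hq hqq' hs hm hg
  have hkw : weightedNorm q s (g - k) ≤ ε := by
    refine le_trans (le_of_eq (eLpNorm_congr_norm_ae (Filter.Eventually.of_forall fun ξ => ?_))) hGle
    have hj := Real.rpow_pos_of_pos (japanese_pos ξ) s
    have : G ξ = ((japanese ξ ^ s : ℝ) : ℂ) * k ξ := by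
      simp only [k]
      rw [← mul_assoc, ← Complex.ofReal_mul, ← Real.rpow_add (japanese_pos ξ), add_neg_cancel,
        Real.rpow_zero, Complex.ofReal_one, one_mul]
    rw [Pi.sub_apply, Pi.sub_apply, this, ← mul_sub, norm_mul, norm_mul, norm_norm, Complex.norm_real]
  set c : ℂ := ∫ ξ, k ξ with hcdef
  -- As `∫ g = 0`, the mean of `k` is minus that of `g - k`, which is small in `L¹`.
  have hc : ‖c‖ₑ ≤ C * ε := by
    have e : ‖c‖ₑ = ‖∫ ξ, (g - k) ξ‖ₑ := by
      simp only [Pi.sub_apply]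
      rw [integral_sub hgi hki, hg0, zero_sub, enorm_neg]
    rw [e]
    refine (enorm_integral_le_lintegral_enorm _).trans ?_
    rw [← eLpNorm_one_eq_lintegral_enorm]
    exact (hCb _ (hm.sub hkc.aestronglyMeasurable)).trans (mul_le_mul_right hkw _)
  refine ⟨k - c • u, hkc.sub (huc.const_smul c), hks.sub (hus.smul_left (f := fun _ => c)), ?_, ?_⟩
  · simp only [Pi.sub_apply, Pi.smul_apply]
    rw [integral_sub hki (g := fun ξ => c • u ξ)
      ((huc.integrable_of_hasCompactSupport hus).smul c), integral_smul, hu1]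
    simp [hcdef]
  · rw [show g - (k - c • u) = (g - k) + c • u by abel]
    refine lt_of_le_of_lt (weightedNorm_add_le hq s (hm.sub hkc.aestronglyMeasurable)
      (huc.aestronglyMeasurable.const_smul c)) (lt_of_le_of_lt ?_ hεδ)
    rw [weightedNorm_smul]
    gcongr

theorem exists_schwartz_fourier_eventually_eq_one (n : ℕ) :
    ∃ Φ : 𝓢(Rn n, ℂ), ∀ᶠ w in 𝓝 (0 : Rn n), 𝓕 (Φ : Rn n → ℂ) w = 1 := by
  let b : ContDiffBump (0 : Rn n) := ⟨1, 2, one_pos, one_lt_two⟩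
  have h1 : HasCompactSupport (Complex.ofRealCLM ∘ b) := b.hasCompactSupport.comp_left rfl
  have hb : ContDiff ℝ ((⊤ : ℕ∞) : WithTop ℕ∞) b := b.contDiff
  have h2 : ContDiff ℝ ((⊤ : ℕ∞) : WithTop ℕ∞) (Complex.ofRealCLM ∘ b) := by fun_prop
  refine ⟨𝓕⁻ (h1.toSchwartzMap h2), ?_⟩
  filter_upwards [Metric.closedBall_mem_nhds (0 : Rn n) one_pos] with w hw
  rw [← SchwartzMap.fourier_coe, FourierTransform.fourier_fourierInv_eq]
  simp [b.one_of_mem_closedBall hw]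

/-- Dilating the kernel by `ε` rescales the function by `ε⁻¹` around `x₀`: this concentrates the
cut-off. -/
theorem synth_dilate {n : ℕ} (x₀ : Rn n) (Φ : Rn n → ℂ) {ε : ℝ} (hε : 0 < ε) (x : Rn n) :
    synth x₀ (fun ξ => ((ε ^ n : ℝ) : ℂ) * Φ (ε • ξ)) x =
      (((2 * Real.pi) ^ n)⁻¹ : ℝ) • 𝓕 Φ (ε⁻¹ • (2 * Real.pi)⁻¹ • (x₀ - x)) := by
  have hpos : (0 : ℝ) < ε ^ n := by positivity
  rw [synth]
  congr 1
  have h := Measure.integral_comp_smul (volume : Measure (Rn n)) (fun v =>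
    Real.fourierChar (-inner ℝ v (ε⁻¹ • (2 * Real.pi)⁻¹ • (x₀ - x))) • Φ v) ε
  rw [finrank_euclideanSpace, Fintype.card_fin, abs_of_pos (by positivity)] at h
  simp only [Real.fourier_eq]
  rw [eq_inv_smul_iff₀ hpos.ne'] at h
  rw [← h, ← integral_smul]
  congr 1
  ext v
  rw [inner_smul_left, inner_smul_right _ _ ε⁻¹]
  simp only [conj_trivial, mul_inv_cancel_left₀ hε.ne', Circle.smul_def, smul_eq_mul,
    Complex.real_smul]
  ring

open ContinuousLinearMap in
-- With `φ = 1` near `x₀`, the function `f - f φ` vanishes near `x₀`, and `f φ` has small norm by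
-- `tendsto_weightedNorm_convolution`.
theorem mem_of_vanishingNear_subset_of_hasCompactSupport {n : ℕ} {q q' s : ℝ} (hq : 1 < q)
    (hqq' : 1 / q + 1 / q' = 1) (hs : n / q' < s) (hs1 : s < n / q' + 1) (x₀ : Rn n)
    {I : Submodule ℂ C(Rn n, ℂ)} (hcl : IsNormClosed q s (I : Set C(Rn n, ℂ)))
    (hI : vanishingNear q s {x₀} ⊆ I) {g : Rn n → ℂ} (hg : Continuous g)
    (hgc : HasCompactSupport g) (hg0 : ∫ ξ, g ξ = 0) {f : C(Rn n, ℂ)}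
    (hf : ∀ x, f x = synth x₀ g x) : f ∈ I := by
  have hc : q.HolderConjugate q' :=
    Real.holderConjugate_iff.2 ⟨hq, by simpa [one_div] using hqq'⟩
  have hs0 : 0 ≤ s := le_trans (div_nonneg n.cast_nonneg hc.symm.pos.le) hs.le
  have hgi : Integrable g := hg.integrable_of_hasCompactSupport hgc
  have hfFL : f ∈ FL n q s := (mem_FL_iff hq hqq' hs x₀).2
    ⟨g, hg.aestronglyMeasurable, weightedNorm_lt_top_of_hasCompactSupport q s hg hgc, hf⟩
  obtain ⟨Φ, hΦ⟩ := exists_schwartz_fourier_eventually_eq_one n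
  refine hcl f hfFL fun δ hδ => ?_
  have ht := tendsto_weightedNorm_convolution hq hqq' hs0 hs1 Φ hg hgc hg0
  obtain ⟨ε, hlt, hε⟩ := ((ht.eventually_lt_const hδ).and self_mem_nhdsWithin).exists
  have hε : 0 < ε := hε
  have hpi : (0 : ℝ) < (2 * Real.pi) ^ n := by positivity
  let k : Rn n → ℂ := fun ξ => ((ε ^ n : ℝ) : ℂ) * Φ (ε • ξ)
  have hki : Integrable k := (Φ.integrable.comp_smul hε.ne').const_mul _
  -- The factor `(2π)ⁿ` cancels the normalization of `synth`, so that `φ` equals exactly 1 near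
  -- `x₀`.
  let φ : C(Rn n, ℂ) := ⟨fun x => (((2 * Real.pi) ^ n : ℝ) : ℂ) * synth x₀ k x,
    continuous_const.mul (continuous_synth x₀ hki)⟩
  have hφ : ∀ x, φ x = 𝓕 (Φ : Rn n → ℂ) (ε⁻¹ • (2 * Real.pi)⁻¹ • (x₀ - x)) := fun x => by
    change _ * synth x₀ _ x = _
    rw [synth_dilate x₀ Φ hε, Complex.real_smul, ← mul_assoc, ← Complex.ofReal_mul,
      mul_inv_cancel₀ hpi.ne', Complex.ofReal_one, one_mul]
  have hφ1 : ∀ᶠ x in 𝓝 x₀, φ x = 1 := by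
    have hct : Filter.Tendsto (fun x : Rn n => ε⁻¹ • (2 * Real.pi)⁻¹ • (x₀ - x)) (𝓝 x₀) (𝓝 0) := by
      have : Continuous fun x : Rn n => ε⁻¹ • (2 * Real.pi)⁻¹ • (x₀ - x) := by fun_prop
      simpa using this.tendsto x₀
    filter_upwards [hct.eventually hΦ] with x hx
    rw [hφ, hx]
  have hfφ : flNorm q s (f * φ) < δ := by
    refine (flNorm_lt_iff hq hqq' hs x₀).2
      ⟨_, (hgi.integrable_convolution (mul ℂ ℂ) hki).1, hlt, fun x => ?_⟩
    rw [ContinuousMap.mul_apply, hf]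
    change synth x₀ g x * ((((2 * Real.pi) ^ n : ℝ) : ℂ) * synth x₀ k x) = _
    rw [mul_left_comm, synth_mul_synth x₀ hgi hki]
    have : ∀ (u : Rn n → ℂ), (((2 * Real.pi) ^ n : ℝ) : ℂ) *
        synth x₀ ((((2 * Real.pi) ^ n)⁻¹ : ℝ) • u) x = synth x₀ u x := fun u => by
      rw [show (((2 * Real.pi) ^ n)⁻¹ : ℝ) • u = ((((2 * Real.pi) ^ n)⁻¹ : ℝ) : ℂ) • u by
        ext; simp, synth_smul, ← mul_assoc, ← Complex.ofReal_mul, mul_inv_cancel₀ hpi.ne',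
        Complex.ofReal_one, one_mul]
    exact this _
  have hfφFL : f * φ ∈ FL n q s := mem_FL_iff_flNorm_lt_top.2 (hfφ.trans_le le_top)
  refine ⟨f - f * φ, hI ⟨sub_mem_FL hq hqq' hs hfFL hfφFL, ?_⟩, by rwa [sub_sub_cancel]⟩
  rw [nhdsSet_singleton]
  filter_upwards [hφ1] with x hx
  simp [hx]

/-- Vanishing at `x₀` means `∫ g = 0`. By density it suffices to treat continuous compactly
supported `g` of mean zero, because the ideal is closed. -/
theorem vanishingIdeal_subset_closedIdealNear {n : ℕ} {q q' s : ℝ} (hq : 1 < q)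
    (hqq' : 1 / q + 1 / q' = 1) (hs : n / q' < s) (hs1 : s < n / q' + 1) (x₀ : Rn n) :
    vanishingIdeal q s {x₀} ⊆ closedIdealNear q s {x₀} := by
  rintro f ⟨hf, hf0⟩
  refine ⟨hf, fun I _ hcl hI => hcl f hf fun δ hδ => ?_⟩
  obtain ⟨g, hm, hg, hfg⟩ := (mem_FL_iff hq hqq' hs x₀).1 hf
  have hg0 : ∫ ξ, g ξ = 0 := by
    have h := hf0 x₀ rfl
    rw [hfg, synth_self, smul_eq_zero] at h
    exact h.resolve_left (by positivity)
  obtain ⟨h, hc, hcs, h0, hlt⟩ :=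
    exists_continuous_integral_eq_zero_weightedNorm_sub_lt hq hqq' hs hm hg hg0 hδ
  have hhi : Integrable h := hc.integrable_of_hasCompactSupport hcs
  have hgi := integrable_of_weighted hq hqq' hs hm hg
  refine ⟨⟨synth x₀ h, continuous_synth x₀ hhi⟩,
    mem_of_vanishingNear_subset_of_hasCompactSupport hq hqq' hs hs1 x₀ hcl hI hc hcs h0 fun _ => rfl, ?_⟩
  refine (flNorm_lt_iff hq hqq' hs x₀).2 ⟨g - h, hm.sub hc.aestronglyMeasurable, hlt, fun x => ?_⟩
  rw [ContinuousMap.sub_apply, hfg]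
  have := synth_add x₀ (hgi.sub hhi) hhi x
  rw [sub_add_cancel] at this
  rw [this]
  simp

end FourierWermer

theorem mainTheorem5 (n : ℕ) (hn : 1 ≤ n) (q q' s : ℝ) (hq : 1 < q) (hqq' : 1 / q + 1 / q' = 1) :
    (q ≤ 2 → n / q' < s → s < n / q' + 1 →
      ∀ x₀ : EuclideanSpace ℝ (Fin n), FourierWermer.IsSpectralSynthesisSet q s {x₀}) ∧
    (n / q' + 1 < s →
      ∀ x₀ : EuclideanSpace ℝ (Fin n), ¬ FourierWermer.IsSpectralSynthesisSet q s {x₀}) := by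
  refine ⟨fun _ hs hs1 x₀ => ?_, fun hs x₀ h => ?_⟩
  · exact (FourierWermer.vanishingIdeal_subset_closedIdealNear hq hqq' hs hs1 x₀).antisymm
      (FourierWermer.closedIdealNear_subset_vanishingIdeal hq hqq' hs x₀)
  · obtain ⟨f, hf, hnd⟩ :=
      FourierWermer.exists_mem_vanishingIdeal_not_hasFDerivAt_zero hn hq hqq' hs x₀
    rw [show FourierWermer.vanishingIdeal q s {x₀} = _ from h] at hf
    exact hnd (FourierWermer.hasFDerivAt_zero_of_mem_closedIdealNear hq hqq' hs x₀ hf)
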